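/- Let $d\ge 2$ and $n\ge 2$ be integers, and let $M=\mathbb R_r\times\mathbb S^{d-1}_\theta$ carry the metric $g=dr^2+\alpha(r)^2g_0$, where $g_0$ is the round metric on the unit sphere $\mathbb S^{d-1}$ and $\alpha\in C^\infty(\mathbb R;(0,\infty))$ satisfies $\alpha(r)=|r|$ for all sufficiently large $|r|$, $\alpha(r)=1+\tfrac12 r^{2n}+O(r^{2n+1})$ as $r\to0$, and $r\alpha'(r)>0$ for all $r\ne 0$. Write points of $T^*M$ as $(r,\theta,\rho,\eta)$, with $\rho,\eta$ the momenta dual to $r,\theta$; put $p_0=|\eta|_{g_0}^2$ and $p=|\xi|_g=\sqrt{\rho^2+\alpha(r)^{-2}p_0}$, let $S^*M=\{p=1\}$, and let $\varphi_t=\exp(tH_p)$ be the homogeneous geodesic flow on $T^*M\setminus0$. Let $\pi:T^*M\to M$ be the projection, and let $\mu_L$ be the Liouville measure on $S^*M$ (the Riemannian volume of $M$ times the surface measure of the unit sphere in each cotangent fibre). Write $r(t),\rho(t)$ for the $r$ and $\rho$ coordinates along a trajectory. Then: 1. The trapped set $K$, that is, the set of all $x\in T^*M\setminus0$ such that $|r(\varphi_t(x))|\not\to\infty$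 as $t\to+\infty$ and $|r(\varphi_t(x))|\not\to\infty$ as $t\to-\infty$, equals $\{r=0,\ \rho=0\}$. 2. For every sufficiently small $\tau>0$ there are $C,T>0$ such that, for every trajectory with $p=1$, $p_0\ge1-\tau$, $r(0)\ge0$, $\rho(0)\ge0$ and every $t\ge T$ with $r(t)\le\tau$, $$r(0)\le Ct^{-\frac1{n-1}},\qquad \rho(0)\le Ct^{-\frac n{n-1}}.$$ 3. For every compact $\mathcal B\subset M$ there is a constant $C>0$ such that the trapped volume $\mathcal V_{\mathcal B}(t)=\mu_L\big(S^*M\cap\pi^{-1}(\mathcal B)\cap\varphi_{-t}(\pi^{-1}(\mathcal B))\big)$ satisfies $$\mathcal V_{\mathcal B}(t)\le Ct^{-\frac{n+1}{n-1}}\qquad\text{for all }t\ge1.$$ -/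

import Mathlib

open scoped ContDiff Topology

noncomputable section

namespace Revolution

/-- The Euclidean space `ℝ^d`, whose unit sphere is `S^(d-1)`. -/
abbrev E (d : ℕ) : Type := EuclideanSpace ℝ (Fin d)

/-- The manifold of revolution `M = ℝ × S^(d-1)` (as a set), sitting in `ℝ × ℝ^d`. -/
def base (d : ℕ) : Set (ℝ × E d) := {q | ‖q.2‖ = 1}

/-- Ambient space `T^*(ℝ × ℝ^d)` of the phase space, with points `(r, θ, ρ, η)`. -/
abbrev Phase (d : ℕ) : Type := ℝ × E d × ℝ × E d

variable {d : ℕ}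

/-- The radial coordinate `r`. -/
def radius (x : Phase d) : ℝ := x.1

/-- The spherical coordinate `θ`. -/
def angle (x : Phase d) : E d := x.2.1

/-- The momentum `ρ` dual to `r`. -/
def radialMomentum (x : Phase d) : ℝ := x.2.2.1

/-- The momentum `η` dual to `θ`. -/
def angularMomentum (x : Phase d) : E d := x.2.2.2

/-- The projection `π : T^*M → M`. -/
def proj (x : Phase d) : ℝ × E d := (radius x, angle x)

/-- `T^*M \ 0`, where `T^*_θ S^(d-1)` is identified with the orthogonal complement of `θ` by the
round metric: `‖θ‖ = 1`, `η ⟂ θ` and `(ρ, η) ≠ 0`. -/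
def cotangent (d : ℕ) : Set (Phase d) :=
  {x | ‖angle x‖ = 1 ∧ inner ℝ (angle x) (angularMomentum x) = 0 ∧
    (radialMomentum x, angularMomentum x) ≠ 0}

/-- `p₀ = |η|²` in the round metric. -/
def p₀ (x : Phase d) : ℝ := ‖angularMomentum x‖ ^ 2

/-- `p = |ξ|_g` for the metric `g = dr² + α(r)² g₀`, that is `p² = ρ² + α(r)⁻² p₀`. -/
def p (α : ℝ → ℝ) (x : Phase d) : ℝ :=
  Real.sqrt (radialMomentum x ^ 2 + (α (radius x) ^ 2)⁻¹ * p₀ x)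

/-- The cosphere bundle `S^*M = {p = 1}`. -/
def cosphere (α : ℝ → ℝ) : Set (Phase d) := {x | x ∈ cotangent d ∧ p α x = 1}

/-- The tangent space at `x` of the submanifold `T^*M` of the ambient space: the kernel of the
differentials of `‖θ‖²` and `⟨θ, η⟩`. -/
def tangentAt (x : Phase d) : Set (Phase d) :=
  {v | inner ℝ (angle x) (angle v) = 0 ∧
    inner ℝ (angle v) (angularMomentum x) + inner ℝ (angle x) (angularMomentum v) = 0}

/-- The canonical symplectic form, with the sign for which the Hamiltonian vector field `X` of `p`
is given by `symplectic X v = dp(v)`. Its restriction to the tangent spaces of `T^*M` is the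
canonical symplectic form of `T^*M`. -/
def symplectic (u v : Phase d) : ℝ :=
  (radius u * radialMomentum v + inner ℝ (angle u) (angularMomentum v))
    - (radialMomentum u * radius v + inner ℝ (angularMomentum u) (angle v))

/-- `X = H_p(x)`: the vector tangent to `T^*M` at `x` which is symplectically dual to `dp`. -/
def IsHamiltonVector (α : ℝ → ℝ) (x X : Phase d) : Prop :=
  X ∈ tangentAt x ∧ ∀ v ∈ tangentAt x, symplectic X v = fderiv ℝ (p α) x v

/-- `γ` is a trajectory `t ↦ φ_t(γ 0)` of the homogeneous geodesic flow `φ_t = exp(t H_p)` on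
`T^*M \ 0`, defined for all times. -/
def IsTrajectory (α : ℝ → ℝ) (γ : ℝ → Phase d) : Prop :=
  ∀ t, γ t ∈ cotangent d ∧ ∃ X, IsHamiltonVector α (γ t) X ∧ HasDerivAt γ X t

/-- `y = φ_t(x)`. (The metric is complete, so through each `x ∈ T^*M \ 0` there passes exactly one
trajectory.) -/
def FlowsTo (α : ℝ → ℝ) (t : ℝ) (x y : Phase d) : Prop :=
  ∃ γ, IsTrajectory α γ ∧ γ 0 = x ∧ γ t = y

/-- The outgoing tail: the points of `T^*M \ 0` whose trajectory does not go to infinity as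
`t → -∞`. -/
def tailPlus (α : ℝ → ℝ) : Set (Phase d) :=
  {x | ∃ γ, IsTrajectory α γ ∧ γ 0 = x ∧
    ¬ Filter.Tendsto (fun t => |radius (γ t)|) Filter.atBot Filter.atTop}

/-- The incoming tail: the points of `T^*M \ 0` whose trajectory does not go to infinity as
`t → +∞`. -/
def tailMinus (α : ℝ → ℝ) : Set (Phase d) :=
  {x | ∃ γ, IsTrajectory α γ ∧ γ 0 = x ∧
    ¬ Filter.Tendsto (fun t => |radius (γ t)|) Filter.atTop Filter.atTop}

/-- The trapped set `K`. -/
def trappedSet (α : ℝ → ℝ) : Set (Phase d) := tailPlus α ∩ tailMinus α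

/-- `𝒯_B(t) = π⁻¹(B) ∩ φ_{-t}(π⁻¹(B))`. -/
def trappedFor (α : ℝ → ℝ) (B : Set (ℝ × E d)) (t : ℝ) : Set (Phase d) :=
  {x | proj x ∈ B ∧ ∃ y, FlowsTo α t x y ∧ proj y ∈ B}

/-- Parametrization of `S^*M` by `ℝ × S^(d-1) × S^(d-1)`. On the fibre over `(r, θ)`, the linear
isometry `w ↦ (⟨θ, w⟩, α(r) (w - ⟨θ, w⟩ θ))` from `ℝ^d` to `T^*_{(r, θ)} M`, with the norm
`(ρ² + α(r)⁻² |η|²)^(1/2)`, maps the unit sphere onto the unit cosphere. -/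
def cosphereParam (α : ℝ → ℝ)
    (z : ℝ × Metric.sphere (0 : E d) 1 × Metric.sphere (0 : E d) 1) : Phase d :=
  (z.1, (z.2.1 : E d), inner ℝ (z.2.1 : E d) (z.2.2 : E d),
    α z.1 • ((z.2.2 : E d) - (inner ℝ (z.2.1 : E d) (z.2.2 : E d) : ℝ) • (z.2.1 : E d)))

/-- Surface measure on the unit sphere `S^(d-1)`. -/
def sphereMeasure (d : ℕ) : MeasureTheory.Measure (Metric.sphere (0 : E d) 1) :=
  (MeasureTheory.volume : MeasureTheory.Measure (E d)).toSphere

/-- The Liouville measure `μ_L` on `S^*M`: the Riemannian volume `α(r)^(d-1) dr dθ` of `M` times the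
surface measure of the unit sphere in each cotangent fibre. -/
def liouville (α : ℝ → ℝ) : MeasureTheory.Measure (Phase d) :=
  (((MeasureTheory.volume : MeasureTheory.Measure ℝ).withDensity
      (fun r => ENNReal.ofReal (α r ^ (d - 1)))).prod
    ((sphereMeasure d).prod (sphereMeasure d))).map (cosphereParam α)

/-- The trapped volume `𝒱_B(t) = μ_L(S^*M ∩ 𝒯_B(t))`. -/
def trappedVolume (α : ℝ → ℝ) (B : Set (ℝ × E d)) (t : ℝ) : ENNReal :=
  liouville α (cosphere α ∩ trappedFor α B t)

end Revolution

end

/-! The radial motion decouples. Along a trajectory `p` and `p₀` are conserved, and with `q = p₀ /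
p²` and `v = ρ / p` one has `r' = v`, `v' = q α'(r) / α(r)³` and `v² + q / α(r)² = 1`. Since `r
α'(r) > 0` off the neck, the force points away from `r = 0` and `(r v)' ≥ v² ≥ 0`. A point off `{r =
0, ρ = 0}` therefore escapes in whichever time direction `r v` points outward
(`IsRadialMotion.tendsto_abs_atTop`), whereas the great circles over `r = 0` stay put; this
identifies the trapped set.

The contact of order `2n` between `α` and `1` makes the force at least a multiple of `|r|^(2n-1)` on
compact sets. An outward solution of `r'' ≥ c r^(2n-1)` that starts at distance `a`, or with speed
`a^n`, exists only for a time `O(a^(-(n-1)))`. Read backwards (`decay_of_repulsive`), an orbit that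
lingers for time `t` starts with `r ≲ δ` and `v ≲ δ^n`, where `δ = t^(-1/(n-1))`.

For the trapped volume this is applied at the midpoint of the time interval, forwards or backwards
according to the sign of `r v` there. The energy identity then forces `|p₀ - 1| ≲ δ^(2n)` on `p = 1`
(`exists_momentum_bound`). In the unit fibre over `(r, θ)` this says that `⟨θ, w⟩²` is within
`O(δ^(2n))` of `1 - α(r)⁻²`, which is at least a multiple of `r^(2n)`. Such bands have measure `≲
δ^(2n) / √(r^(2n) + δ^(2n))`, and integrating over `r = δ u` yields `δ^(n+1)`
(`exists_liouville_nearCritical_le`). -/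

namespace Revolution


/-! ### Lifespan of solutions of a repulsive differential inequality -/

/-- A nonnegative solution of `r'' ≥ c r^(2m+3)` with `r 0 > 0` cannot live longer than a multiple
of `r(0)^(-(m+1))`. -/
theorem lifespan_le_of_position (m : ℕ) {c : ℝ} (hc : 0 < c) :
    ∃ C : ℝ, 1 ≤ C ∧ ∀ (r v g : ℝ → ℝ) (t : ℝ),
      (∀ s, HasDerivAt r (v s) s) → (∀ s, HasDerivAt v (g s) s) →
      (∀ s ∈ Set.Icc 0 t, 0 ≤ r s ∧ 0 ≤ v s ∧ c * r s ^ (2 * m + 3) ≤ g s) →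
      0 < r 0 → 0 ≤ t → t * r 0 ^ (m + 1) ≤ C := by
  -- This `k` is the constant in `r' ≥ k r^(m+2)`, left over after the `a^(2m+4)` term of the energy
  -- inequality is absorbed into `v²`.
  obtain ⟨k, hk, hk2⟩ : ∃ k : ℝ, 0 < k ∧ k ^ 2 * (1 + 1 / ((m + 2) * c)) = c / (m + 2) := by
    refine ⟨√(c / (m + 2) / (1 + 1 / ((m + 2) * c))), by positivity, ?_⟩
    rw [Real.sq_sqrt (by positivity)]
    field_simp
  refine ⟨1 + 1 / ((m + 1) * k), by simp; positivity, ?_⟩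
  intro r v g t hr hv H h0 ht
  set a := r 0 with ha
  have hrc : Continuous r := continuous_iff_continuousAt.2 fun s => (hr s).continuousAt
  have hvc : Continuous v := continuous_iff_continuousAt.2 fun s => (hv s).continuousAt
  have hrmono : MonotoneOn r (Set.Icc 0 t) :=
    monotoneOn_of_hasDerivWithinAt_nonneg (convex_Icc 0 t) hrc.continuousOn
      (fun s _ => (hr s).hasDerivWithinAt) fun s hs => (H s (interior_subset hs)).2.1
  have hra : ∀ s ∈ Set.Icc 0 t, a ≤ r s := fun s hs =>
    hrmono ⟨le_rfl, ht⟩ hs hs.1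
  have hvlow : ∀ s ∈ Set.Icc 0 t, c * a ^ (2 * m + 3) * s ≤ v s := by
    intro s hs
    have hmono : MonotoneOn (fun s => v s - c * a ^ (2 * m + 3) * s) (Set.Icc 0 t) := by
      refine monotoneOn_of_hasDerivWithinAt_nonneg (convex_Icc 0 t) (by fun_prop)
        (f' := fun s => g s - c * a ^ (2 * m + 3) * 1)
        (fun s _ => ((hv s).sub ((hasDerivAt_id s).const_mul _)).hasDerivWithinAt) fun s hs => ?_
      have h1 := H s (interior_subset hs)
      have h2 := hra s (interior_subset hs)
      have : c * a ^ (2 * m + 3) ≤ c * r s ^ (2 * m + 3) := by gcongr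
      linarith [h1.2.2]
    have h1 := hmono ⟨le_rfl, ht⟩ hs hs.1
    have h2 := (H 0 ⟨le_rfl, ht⟩).2.1
    simp only [mul_zero, sub_zero] at h1
    linarith
  have henergy : ∀ s ∈ Set.Icc 0 t,
      c / (m + 2) * (r s ^ (2 * m + 4) - a ^ (2 * m + 4)) ≤ v s ^ 2 := by
    intro s hs
    have hmono : MonotoneOn (fun s => v s ^ 2 - c / (m + 2) * r s ^ (2 * m + 4))
        (Set.Icc 0 t) := by
      refine monotoneOn_of_hasDerivWithinAt_nonneg (convex_Icc 0 t) (by fun_prop)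
        (fun s _ => (((hv s).pow 2).sub (((hr s).pow (2 * m + 4)).const_mul _)).hasDerivWithinAt)
        fun s hs => ?_
      have h1 := H s (interior_subset hs)
      have h2 : c / (m + 2) * (((2 * m + 4 : ℕ) : ℝ) * r s ^ (2 * m + 4 - 1) * v s)
          = 2 * v s * (c * r s ^ (2 * m + 3)) := by
        push_cast
        field_simp
        ring
      rw [h2]
      norm_num
      nlinarith [mul_le_mul_of_nonneg_left h1.2.2 h1.2.1]
    have h1 := hmono ⟨le_rfl, ht⟩ hs hs.1
    simp only at h1
    nlinarith [sq_nonneg (v 0)]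
  have ham : 0 < a ^ (m + 1) := by positivity
  -- The natural time scale at height `a`: by time `s₁` the constant lower bound on the force has
  -- produced the speed `c a^(m+2)`.
  set s₁ := (a ^ (m + 1))⁻¹ with hs₁
  have hs₁pos : 0 < s₁ := by positivity
  have hs₁a : s₁ * a ^ (m + 1) = 1 := inv_mul_cancel₀ ham.ne'
  rcases le_total t s₁ with hle | hle
  · have : t * a ^ (m + 1) ≤ s₁ * a ^ (m + 1) := by gcongr
    have h3 : 0 ≤ 1 / ((m + 1) * k) := by positivity
    linarith
  have hkv : ∀ s ∈ Set.Icc s₁ t, k * r s ^ (m + 2) ≤ v s := by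
    intro s hs
    have hs' : s ∈ Set.Icc 0 t := ⟨hs₁pos.le.trans hs.1, hs.2⟩
    have h1 : c * a ^ (m + 2) ≤ v s := by
      refine le_trans ?_ (hvlow s hs')
      calc c * a ^ (m + 2) = c * a ^ (2 * m + 3) * s₁ := by
            rw [show 2 * m + 3 = (m + 2) + (m + 1) by ring, pow_add]
            linear_combination (-c * a ^ (m + 2)) * hs₁a
        _ ≤ c * a ^ (2 * m + 3) * s := by gcongr; exact hs.1
    have h2 := henergy s hs'
    have h3 : c ^ 2 * a ^ (2 * m + 4) ≤ v s ^ 2 := by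
      calc c ^ 2 * a ^ (2 * m + 4) = (c * a ^ (m + 2)) ^ 2 := by ring
        _ ≤ v s ^ 2 := by gcongr
    have h4 : c / (m + 2) * a ^ (2 * m + 4) ≤ 1 / ((m + 2) * c) * v s ^ 2 := by
      calc _ = 1 / ((m + 2) * c) * (c ^ 2 * a ^ (2 * m + 4)) := by field_simp
        _ ≤ _ := by gcongr
    have h5 : (1 + 1 / ((m + 2) * c)) * (k * r s ^ (m + 2)) ^ 2
        ≤ (1 + 1 / ((m + 2) * c)) * v s ^ 2 := by
      calc _ = k ^ 2 * (1 + 1 / ((m + 2) * c)) * r s ^ (2 * m + 4) := by ring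
        _ = c / (m + 2) * r s ^ (2 * m + 4) := by rw [hk2]
        _ ≤ _ := by linarith
    have h6 := le_of_mul_le_mul_left h5 (by positivity)
    exact le_of_sq_le_sq h6 (H s hs').2.1
  have hrpos : ∀ s ∈ Set.Icc s₁ t, 0 < r s := fun s hs =>
    h0.trans_le (hra s ⟨hs₁pos.le.trans hs.1, hs.2⟩)
  -- Integrating `r' ≥ k r^(m+2)`: the positive quantity `r^(-(m+1))` is at most `s₁` at time `s₁`
  -- and falls at rate at least `(m+1) k`, which bounds `t - s₁`.
  have hanti : AntitoneOn (fun s => (r s ^ (m + 1))⁻¹ + (m + 1) * k * s) (Set.Icc s₁ t) := by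
    refine antitoneOn_of_hasDerivWithinAt_nonpos (convex_Icc s₁ t) ?_
      (f' := fun s => -(((m + 1 : ℕ) : ℝ) * r s ^ m * v s) / (r s ^ (m + 1)) ^ 2
        + (m + 1) * k * 1)
      (fun s hs => ?_) fun s hs => ?_
    · refine ContinuousOn.add (ContinuousOn.inv₀ (by fun_prop) fun s hs => ?_) (by fun_prop)
      exact (pow_pos (hrpos s hs) _).ne'
    · have h := (hrpos s (interior_subset hs))
      exact ((((hr s).pow (m + 1)).inv (pow_pos h _).ne').add
        ((hasDerivAt_id s).const_mul _)).hasDerivWithinAt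
    · have h := (hrpos s (interior_subset hs))
      have h1 := hkv s (interior_subset hs)
      have h2 : (m + 1) * k * (r s ^ (m + 1)) ^ 2 ≤ (m + 1) * r s ^ m * v s := by
        calc _ = (m + 1) * r s ^ m * (k * r s ^ (m + 2)) := by ring
          _ ≤ _ := by gcongr
      have h3 : (m + 1) * k ≤ (m + 1) * r s ^ m * v s / (r s ^ (m + 1)) ^ 2 := by
        rwa [le_div_iff₀ (by positivity)]
      push_cast
      rw [neg_div]
      linarith
  have hfin := hanti ⟨le_rfl, hle⟩ ⟨hle, le_rfl⟩ hle
  simp only at hfin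
  have h1 : (r s₁ ^ (m + 1))⁻¹ ≤ s₁ := by
    rw [hs₁]
    have := hra s₁ ⟨hs₁pos.le, hle⟩
    gcongr
  have h2 : 0 ≤ (r t ^ (m + 1))⁻¹ := by
    have := hrpos t ⟨hle, le_rfl⟩
    positivity
  have h3 : (m + 1) * k * (t - s₁) ≤ s₁ := by linarith
  have h4 : t - s₁ ≤ s₁ / ((m + 1) * k) := by
    rw [le_div_iff₀ (by positivity)]; linarith
  calc t * a ^ (m + 1) ≤ (s₁ + s₁ / ((m + 1) * k)) * a ^ (m + 1) := by gcongr; linarith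
    _ = s₁ * a ^ (m + 1) * (1 + 1 / ((m + 1) * k)) := by ring
    _ = _ := by rw [hs₁a, one_mul]

/-- A nonnegative solution of `r'' ≥ c r^(2m+3)` with `r'(0) ≥ a^(m+2) > 0` cannot live longer than
a multiple of `a^(-(m+1))`. -/
theorem lifespan_le_of_velocity (m : ℕ) {c : ℝ} (hc : 0 < c) :
    ∃ C : ℝ, 1 ≤ C ∧ ∀ (r v g : ℝ → ℝ) (t a : ℝ),
      (∀ s, HasDerivAt r (v s) s) → (∀ s, HasDerivAt v (g s) s) →
      (∀ s ∈ Set.Icc 0 t, 0 ≤ r s ∧ 0 ≤ v s ∧ c * r s ^ (2 * m + 3) ≤ g s) →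
      0 < a → a ^ (m + 2) ≤ v 0 → 0 ≤ t → t * a ^ (m + 1) ≤ C := by
  obtain ⟨C, hC1, hC⟩ := lifespan_le_of_position m hc
  refine ⟨1 + C, by linarith, fun r v g t a hr hv H ha hav ht => ?_⟩
  have hrc : Continuous r := continuous_iff_continuousAt.2 fun s => (hr s).continuousAt
  have hvc : Continuous v := continuous_iff_continuousAt.2 fun s => (hv s).continuousAt
  have ham : 0 < a ^ (m + 1) := by positivity
  set s₁ := (a ^ (m + 1))⁻¹ with hs₁
  have hs₁pos : 0 < s₁ := by positivity
  have hs₁a : s₁ * a ^ (m + 1) = 1 := inv_mul_cancel₀ ham.ne'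
  rcases le_total t s₁ with hle | hle
  · have : t * a ^ (m + 1) ≤ s₁ * a ^ (m + 1) := by gcongr
    linarith
  have hvmono : MonotoneOn v (Set.Icc 0 t) :=
    monotoneOn_of_hasDerivWithinAt_nonneg (convex_Icc 0 t) hvc.continuousOn
      (fun s _ => (hv s).hasDerivWithinAt) fun s hs => by
        have h := H s (interior_subset hs)
        have := pow_nonneg h.1 (2 * m + 3)
        exact le_trans (by positivity) h.2.2
  have hmono : MonotoneOn (fun s => r s - a ^ (m + 2) * s) (Set.Icc 0 t) := by
    refine monotoneOn_of_hasDerivWithinAt_nonneg (convex_Icc 0 t) (by fun_prop)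
      (f' := fun s => v s - a ^ (m + 2) * 1)
      (fun s _ => ((hr s).sub ((hasDerivAt_id s).const_mul _)).hasDerivWithinAt) fun s hs => ?_
    have := hvmono ⟨le_rfl, ht⟩ (interior_subset hs) (interior_subset hs).1
    linarith
  have h1 := hmono ⟨le_rfl, ht⟩ ⟨hs₁pos.le, hle⟩ hs₁pos.le
  have h0 := (H 0 ⟨le_rfl, ht⟩).1
  have h2 : a ≤ r s₁ := by
    -- The velocity never drops below `a^(m+2)`, so by time `s₁` the position has reached `a` and
    -- the previous lifespan bound takes over.
    have : a ^ (m + 2) * s₁ = a := by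
      rw [pow_succ]; linear_combination a * hs₁a
    simp only [mul_zero, sub_zero] at h1
    linarith
  have h3 := hC (fun s => r (s + s₁)) (fun s => v (s + s₁)) (fun s => g (s + s₁)) (t - s₁)
    (fun s => (hr (s + s₁)).comp_add_const s s₁) (fun s => (hv (s + s₁)).comp_add_const s s₁)
    (fun s hs => H _ ⟨by linarith [hs.1], by linarith [hs.2]⟩)
    (by simpa using ha.trans_le h2) (by linarith)
  simp only [zero_add] at h3
  have h4 : (t - s₁) * a ^ (m + 1) ≤ (t - s₁) * r s₁ ^ (m + 1) := by
    have : 0 ≤ t - s₁ := by linarith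
    gcongr
  nlinarith

/-- If `r r'' ≥ 0`, then `r` and `r'` remain nonnegative once they are nonnegative and not both
zero. -/
theorem nonneg_of_repulsive {r v g : ℝ → ℝ} (hr : ∀ s, HasDerivAt r (v s) s)
    (hv : ∀ s, HasDerivAt v (g s) s) (hg : ∀ s, 0 ≤ r s * g s)
    (h0 : 0 ≤ r 0) (h0' : 0 ≤ v 0) (hne : ¬ (r 0 = 0 ∧ v 0 = 0)) {s : ℝ} (hs : 0 ≤ s) :
    0 ≤ r s ∧ 0 ≤ v s := by
  have hrc : Continuous r := continuous_iff_continuousAt.2 fun s => (hr s).continuousAt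
  have hvc : Continuous v := continuous_iff_continuousAt.2 fun s => (hv s).continuousAt
  have hprod : Monotone fun s => r s * v s :=
    monotone_of_hasDerivAt_nonneg (fun s => (hr s).mul (hv s)) fun s => by
      have := hg s
      simp only [Pi.zero_apply]
      nlinarith [mul_self_nonneg (v s)]
  have hrv : ∀ s, 0 ≤ s → 0 ≤ r s * v s := fun s hs =>
    (mul_nonneg h0 h0').trans (hprod hs)
  -- By the intermediate value theorem it suffices to show that one factor of `r v ≥ 0` never
  -- vanishes: `r` if `r 0 > 0`, otherwise `v`.
  have key : ∀ f : ℝ → ℝ, Continuous f → 0 < f 0 → (∀ s, 0 ≤ s → f s ≠ 0) →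
      ∀ s, 0 ≤ s → 0 < f s := by
    intro f hf hf0 hfne s hs
    by_contra! hcon
    obtain ⟨y, hy, hy0⟩ := intermediate_value_Icc' hs hf.continuousOn ⟨hcon, hf0.le⟩
    exact hfne y hy.1 hy0
  rcases h0.lt_or_eq with hpos | heq
  · have hsq : MonotoneOn (fun s => r s ^ 2) (Set.Ici 0) :=
      monotoneOn_of_hasDerivWithinAt_nonneg (convex_Ici 0) (by fun_prop)
        (fun s _ => ((hr s).pow 2).hasDerivWithinAt) fun s hs => by
          have := hrv s (interior_subset hs)
          norm_num
          nlinarith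
    have hrp := key r hrc hpos (fun s hs h => by
      have := hsq (Set.mem_Ici.2 le_rfl) hs hs
      simp only [h] at this
      nlinarith) s hs
    exact ⟨hrp.le, nonneg_of_mul_nonneg_right (hrv s hs) hrp⟩
  · have hv0 : 0 < v 0 := lt_of_le_of_ne h0' fun h => hne ⟨heq.symm, h.symm⟩
    have hvp : ∀ s, 0 ≤ s → 0 < v s := by
      refine key v hvc hv0 fun s hs hvs => ?_
      have hs0 : 0 < s := hs.lt_of_ne fun h => by subst h; exact hv0.ne' hvs
      -- A zero of `v` would make the monotone function `r v` vanish just to the right of `0`,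
      -- although its derivative at `0` is `v(0)² > 0`.
      have hd : HasDerivAt (fun s => r s * v s) (v 0 * v 0 + r 0 * g 0) 0 := (hr 0).mul (hv 0)
      have hzero : ∀ᶠ x in 𝓝[>] (0 : ℝ), r x * v x = 0 := by
        filter_upwards [Ioc_mem_nhdsGT hs0] with x hx
        have h1 := hprod hx.2
        simp only [hvs, mul_zero] at h1
        exact le_antisymm h1 (hrv x hx.1.le)
      have hd2 : HasDerivWithinAt (fun s => r s * v s) 0 (Set.Ioi 0) 0 :=
        (hasDerivWithinAt_const (0 : ℝ) (Set.Ioi 0) (0 : ℝ)).congr_of_eventuallyEq hzero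
          (by simp [← heq])
      have := (uniqueDiffWithinAt_Ioi (0 : ℝ)).eq_deriv _ hd.hasDerivWithinAt hd2
      rw [← heq] at this
      nlinarith
    refine ⟨?_, (hvp s hs).le⟩
    exact nonneg_of_mul_nonneg_left (hrv s hs) (hvp s hs)

/-! ### Taylor expansion at the neck and bounds for the profile -/

section

open Asymptotics Filter

/-- The derivatives of order at most `N` of a smooth function which is `O(x^(N+1))` vanish. -/
theorem iteratedDeriv_eq_zero_of_isBigO {f : ℝ → ℝ} (hf : ContDiff ℝ ∞ f) {N : ℕ}
    (hO : f =O[𝓝 0] fun x : ℝ => x ^ (N + 1)) (k : ℕ) (hk : k ≤ N) :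
    iteratedDeriv k f 0 = 0 := by
  induction k using Nat.strong_induction_on with
  | _ k ih =>
    have h1 := taylor_isLittleO_univ (x₀ := 0) (hf.of_le (m := (k : ℕ∞ω)) (by exact_mod_cast le_top))
    have h2 : ∀ x : ℝ, taylorWithinEval f k Set.univ 0 x =
        ((k.factorial : ℝ)⁻¹ * iteratedDeriv k f 0) * x ^ k := by
      intro x
      rw [taylor_within_apply, Finset.sum_eq_single_of_mem k (by simp)]
      · simp [iteratedDerivWithin_univ]; ring
      · intro j hj hjk
        have hj' : j < k := by simp at hj; omega
        simp [iteratedDerivWithin_univ, ih j hj' (by omega)]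
    simp only [h2, sub_zero] at h1
    have h3 : f =o[𝓝 0] fun x : ℝ => x ^ k :=
      hO.trans_isLittleO (isLittleO_pow_pow (by omega))
    have h4 := (h3.sub h1).congr_left (f₂ := fun x =>
      ((k.factorial : ℝ)⁻¹ * iteratedDeriv k f 0) * x ^ k) (fun x => by ring)
    -- If the coefficient of order `k` were nonzero, `x^k` would be `o(x^k)`.
    by_contra hne
    have hc : ((k.factorial : ℝ)⁻¹ * iteratedDeriv k f 0) ≠ 0 := by positivity
    have h5 : (fun x : ℝ => x ^ k) =o[𝓝 0] fun x : ℝ => x ^ k :=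
      (isLittleO_const_mul_left_iff hc).1 h4
    have h6 : ∃ᶠ x : ℝ in 𝓝 0, x ^ k ≠ 0 := by
      have : ∀ᶠ x : ℝ in 𝓝[≠] (0 : ℝ), x ^ k ≠ 0 :=
        eventually_mem_nhdsWithin.mono fun x hx => pow_ne_zero k hx
      exact this.frequently.filter_mono nhdsWithin_le_nhds
    exact isLittleO_irrefl h6 h5

/-- The derivative of a smooth function which is `O(x^(N+2))` is `o(x^N)`. -/
theorem deriv_isLittleO_of_isBigO {f : ℝ → ℝ} (hf : ContDiff ℝ ∞ f) {N : ℕ}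
    (hO : f =O[𝓝 0] fun x : ℝ => x ^ (N + 2)) :
    deriv f =o[𝓝 0] fun x : ℝ => x ^ N := by
  have hd : ContDiff ℝ N (deriv f) :=
    ((contDiff_infty_iff_deriv.1 hf).2).of_le (by exact_mod_cast le_top)
  have h1 := taylor_isLittleO_univ (x₀ := 0) hd
  refine (h1.congr_left fun x => ?_).congr_right fun x => by rw [sub_zero]
  rw [taylor_within_apply, Finset.sum_eq_zero, sub_zero]
  intro j hj
  have hj' : j < N + 1 := by simpa using hj
  rw [iteratedDerivWithin_univ, ← iteratedDeriv_succ',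
    iteratedDeriv_eq_zero_of_isBigO hf hO (j + 1) (by omega), smul_zero]

/-- A continuous function which is positive off `0` and dominates `x^N` near `0` dominates it on
every compact set. -/
theorem exists_pow_le_on_compact {f : ℝ → ℝ} {N : ℕ} (hf : Continuous f)
    (hpos : ∀ x, x ≠ 0 → 0 < f x) {c₀ : ℝ} (hc₀ : 0 < c₀)
    (hnear : ∀ᶠ x in 𝓝 (0 : ℝ), c₀ * |x| ^ N ≤ f x) (R : ℝ) :
    ∃ c : ℝ, 0 < c ∧ ∀ x, |x| ≤ R → c * |x| ^ N ≤ f x := by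
  obtain ⟨ε, hε, hball⟩ := Metric.eventually_nhds_iff.1 hnear
  have hK : IsCompact (Set.Icc (-R) R \ Metric.ball 0 ε) :=
    isCompact_Icc.diff Metric.isOpen_ball
  rcases (Set.Icc (-R) R \ Metric.ball 0 ε).eq_empty_or_nonempty with he | hne
  · refine ⟨c₀, hc₀, fun x hx => hball ?_⟩
    by_contra h
    have : x ∈ Set.Icc (-R) R \ Metric.ball 0 ε := ⟨abs_le.1 hx, h⟩
    simp [he] at this
  · obtain ⟨y, hy, hmin⟩ := hK.exists_isMinOn hne hf.continuousOn
    have hy0 : y ≠ 0 := by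
      rintro rfl
      exact hy.2 (Metric.mem_ball_self hε)
    have hR : 0 ≤ R := by linarith [hy.1.1, hy.1.2]
    have hfy := hpos y hy0
    refine ⟨min c₀ (f y / (1 + R ^ N)), by positivity, fun x hx => ?_⟩
    by_cases hxb : x ∈ Metric.ball 0 ε
    · exact (mul_le_mul_of_nonneg_right (min_le_left _ _) (by positivity)).trans (hball hxb)
    · have h1 : f y ≤ f x := hmin ⟨abs_le.1 hx, hxb⟩
      calc _ ≤ f y / (1 + R ^ N) * R ^ N := by
            gcongr
            exact min_le_right _ _
        _ ≤ f y := by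
            rw [div_mul_eq_mul_div, div_le_iff₀ (by positivity)]
            nlinarith
        _ ≤ f x := h1

/-- A continuous function which is `O(x^N)` near `0` is bounded by a multiple of `x^N` on every
compact set. -/
theorem exists_le_pow_on_compact {f : ℝ → ℝ} {N : ℕ} (hf : Continuous f)
    (hO : f =O[𝓝 0] fun x : ℝ => x ^ N) (R : ℝ) :
    ∃ C : ℝ, 0 < C ∧ ∀ x, |x| ≤ R → f x ≤ C * |x| ^ N := by
  obtain ⟨C₀, hC₀, hnear⟩ := hO.exists_pos
  obtain ⟨ε, hε, hball⟩ := Metric.eventually_nhds_iff.1 hnear.bound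
  obtain ⟨D, hD⟩ := (isCompact_Icc (a := -R) (b := R)).exists_bound_of_continuousOn hf.continuousOn
  refine ⟨max C₀ (|D| / ε ^ N), by positivity, fun x hx => ?_⟩
  by_cases hxb : x ∈ Metric.ball 0 ε
  · have := hball hxb
    simp only [norm_pow, Real.norm_eq_abs] at this
    calc f x ≤ C₀ * |x| ^ N := (le_abs_self _).trans this
      _ ≤ _ := by gcongr; exact le_max_left _ _
  · have h1 : ε ≤ |x| := by simpa using hxb
    calc f x ≤ |D| := ((le_abs_self _).trans (hD x (abs_le.1 hx))).trans (le_abs_self D)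
      _ = |D| / ε ^ N * ε ^ N := by field_simp
      _ ≤ _ := by gcongr; exact le_max_right _ _

section Profile

variable {n : ℕ} {α : ℝ → ℝ}

/-- The filter `𝓝 0` sees the point `0` itself, where the error term vanishes. -/
theorem profile_zero (hzero : (fun r : ℝ => α r - (1 + r ^ (2 * n) / 2)) =O[𝓝 0]
    fun r : ℝ => r ^ (2 * n + 1)) (hn : 2 ≤ n) : α 0 = 1 := by
  obtain ⟨C, hC⟩ := hzero.bound
  have h := hC.self_of_nhds
  simp [show n ≠ 0 by omega] at h
  linarith

/-- The continuous function `α'` has the sign of `r`, so its two one-sided limits squeeze it. -/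
theorem deriv_profile_zero (hsmooth : ContDiff ℝ ∞ α)
    (hmono : ∀ r : ℝ, r ≠ 0 → 0 < r * deriv α r) : deriv α 0 = 0 := by
  have hc : Continuous (deriv α) := (contDiff_infty_iff_deriv.1 hsmooth).2.continuous
  refine le_antisymm ?_ ?_
  · refine le_of_tendsto (hc.continuousWithinAt (s := Set.Iio 0) (x := 0)) ?_
    filter_upwards [self_mem_nhdsWithin] with x hx
    have := hmono x (ne_of_lt hx)
    have hx' : x < 0 := hx
    nlinarith
  · refine ge_of_tendsto (hc.continuousWithinAt (s := Set.Ioi 0) (x := 0)) ?_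
    filter_upwards [self_mem_nhdsWithin] with x hx
    exact (pos_of_mul_pos_right (hmono x (ne_of_gt hx)) (le_of_lt hx)).le

theorem one_lt_profile (hsmooth : ContDiff ℝ ∞ α)
    (hmono : ∀ r : ℝ, r ≠ 0 → 0 < r * deriv α r) (h0 : α 0 = 1) {r : ℝ} (hr : r ≠ 0) :
    1 < α r := by
  have hd : Differentiable ℝ α := hsmooth.differentiable (by simp)
  rcases hr.lt_or_gt with h | h
  · have : StrictAntiOn α (Set.Iic 0) := by
      refine strictAntiOn_of_deriv_neg (convex_Iic 0) hd.continuous.continuousOn fun x hx => ?_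
      simp only [interior_Iic, Set.mem_Iio] at hx
      have := hmono x hx.ne
      nlinarith
    simpa [h0] using this h.le Set.self_mem_Iic h
  · have : StrictMonoOn α (Set.Ici 0) := by
      refine strictMonoOn_of_deriv_pos (convex_Ici 0) hd.continuous.continuousOn fun x hx => ?_
      simp only [interior_Ici, Set.mem_Ioi] at hx
      exact pos_of_mul_pos_right (hmono x hx.ne') hx.le
    simpa [h0] using this Set.self_mem_Ici h.le h

theorem one_le_profile (hsmooth : ContDiff ℝ ∞ α)
    (hmono : ∀ r : ℝ, r ≠ 0 → 0 < r * deriv α r) (h0 : α 0 = 1) (r : ℝ) : 1 ≤ α r := by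
  by_cases hr : r = 0
  · rw [hr, h0]
  · exact (one_lt_profile hsmooth hmono h0 hr).le

/-- The radial force is bounded below by a multiple of `r^(2n-1)` on compact sets. -/
theorem exists_force_lower_bound (hn : 2 ≤ n) (hsmooth : ContDiff ℝ ∞ α) (hpos : ∀ r, 0 < α r)
    (hzero : (fun r : ℝ => α r - (1 + r ^ (2 * n) / 2)) =O[𝓝 0] fun r : ℝ => r ^ (2 * n + 1))
    (hmono : ∀ r : ℝ, r ≠ 0 → 0 < r * deriv α r) (R : ℝ) :
    ∃ c : ℝ, 0 < c ∧ ∀ r, |r| ≤ R → c * |r| ^ (2 * n) ≤ r * (deriv α r / α r ^ 3) := by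
  have hd : Differentiable ℝ α := hsmooth.differentiable (by simp)
  have hc : Continuous (deriv α) := (contDiff_infty_iff_deriv.1 hsmooth).2.continuous
  have hα := hd.continuous
  -- Near `0`, `r α' ≥ r^(2n) / 2` and `α³ ≤ 8`, hence the constant `1 / 16`. The expansion of `α`
  -- may be differentiated because the remainder is smooth.
  refine exists_pow_le_on_compact (c₀ := 1 / 16) ?_ ?_ (by norm_num) ?_ R
  · exact continuous_id.mul (hc.div (hα.pow 3) fun r => (pow_pos (hpos r) 3).ne')
  · intro r hr
    rw [← mul_div_assoc]
    exact div_pos (hmono r hr) (pow_pos (hpos r) 3)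
  · have hb : ContDiff ℝ ∞ fun r : ℝ => α r - (1 + r ^ (2 * n) / 2) := by fun_prop
    have h1 := deriv_isLittleO_of_isBigO hb (N := 2 * n - 1)
      (hzero.congr_right fun r => by congr 1; omega)
    have h2 : ∀ᶠ r in 𝓝 (0 : ℝ), α r < 2 :=
      hα.continuousAt.eventually_lt_const (by rw [profile_zero hzero hn]; norm_num)
    filter_upwards [h1.bound (show (0 : ℝ) < 1 / 2 by norm_num), h2] with r hr hr2
    have h3 : deriv (fun r : ℝ => α r - (1 + r ^ (2 * n) / 2)) r
        = deriv α r - n * r ^ (2 * n - 1) := by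
      have : HasDerivAt (fun r : ℝ => α r - (1 + r ^ (2 * n) / 2)) _ r :=
        (hd r).hasDerivAt.sub (((hasDerivAt_pow (2 * n) r).div_const 2).const_add 1)
      rw [this.deriv]
      push_cast
      ring
    rw [h3, norm_pow, Real.norm_eq_abs, Real.norm_eq_abs] at hr
    have h4 : |r| ^ (2 * n) = r ^ (2 * n) := (even_two_mul n).pow_abs r
    have h5 : r * r ^ (2 * n - 1) = r ^ (2 * n) := by
      rw [← pow_succ']; congr 1; omega
    have h5' : |r| * |r| ^ (2 * n - 1) = r ^ (2 * n) := by
      rw [← h4, ← pow_succ']; congr 1; omega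
    have h6 : |r * deriv α r - n * r ^ (2 * n)| ≤ 1 / 2 * r ^ (2 * n) := by
      calc |r * deriv α r - n * r ^ (2 * n)| = |r| * |deriv α r - n * r ^ (2 * n - 1)| := by
            rw [← abs_mul, ← h5]; congr 1; ring
        _ ≤ |r| * (1 / 2 * |r| ^ (2 * n - 1)) := by gcongr
        _ = _ := by rw [← h5']; ring
    have hn' : (2 : ℝ) ≤ n := by exact_mod_cast hn
    have hrp : 0 ≤ r ^ (2 * n) := (even_two_mul n).pow_nonneg r
    have h7 : 1 / 2 * r ^ (2 * n) ≤ r * deriv α r := by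
      have := (abs_le.1 h6).1
      nlinarith
    have h8 : α r ^ 3 ≤ 8 := by
      calc α r ^ 3 ≤ 2 ^ 3 := pow_le_pow_left₀ (hpos r).le hr2.le 3
        _ = 8 := by norm_num
    rw [h4, ← mul_div_assoc, le_div_iff₀ (pow_pos (hpos r) 3)]
    nlinarith

/-- On `p = p₀ = 1` one has `ρ² = 1 - α(r)⁻²`, so this controls how far the critical momenta are
from `ρ = 0`. Near `0`, `1 - α⁻² = (α - 1) (α + 1) / α²` with both `α - 1 ≥ r^(2n) / 4` and `(α + 1)
/ α² ≥ 1 / 4`. -/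
theorem exists_profile_lower_bound (hn : 2 ≤ n) (hsmooth : ContDiff ℝ ∞ α)
    (hzero : (fun r : ℝ => α r - (1 + r ^ (2 * n) / 2)) =O[𝓝 0] fun r : ℝ => r ^ (2 * n + 1))
    (hmono : ∀ r : ℝ, r ≠ 0 → 0 < r * deriv α r) (R : ℝ) :
    ∃ c : ℝ, 0 < c ∧ ∀ r, |r| ≤ R → c * |r| ^ (2 * n) ≤ 1 - (α r ^ 2)⁻¹ := by
  have h0 := profile_zero hzero hn
  have hα := hsmooth.continuous
  have hle := one_le_profile hsmooth hmono h0
  refine exists_pow_le_on_compact (c₀ := 1 / 16) ?_ ?_ (by norm_num) ?_ R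
  · exact continuous_const.sub ((hα.pow 2).inv₀ fun r => (pow_pos (one_pos.trans_le (hle r)) 2).ne')
  · intro r hr
    have := one_lt_profile hsmooth hmono h0 hr
    have : (α r ^ 2)⁻¹ < 1 := inv_lt_one_of_one_lt₀ (by nlinarith)
    linarith
  · have h2 : ∀ᶠ r in 𝓝 (0 : ℝ), α r < 2 :=
      hα.continuousAt.eventually_lt_const (by rw [h0]; norm_num)
    have h1 := hzero.trans_isLittleO (isLittleO_pow_pow (show 2 * n < 2 * n + 1 by omega))
    filter_upwards [h1.bound (show (0 : ℝ) < 1 / 4 by norm_num), h2] with r hr hr2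
    have h4 : |r| ^ (2 * n) = r ^ (2 * n) := (even_two_mul n).pow_abs r
    rw [norm_pow, Real.norm_eq_abs, Real.norm_eq_abs, h4] at hr
    have h5 := (abs_le.1 hr).1
    have h6 : 1 / 4 * r ^ (2 * n) ≤ α r - 1 := by linarith
    have h7 := hle r
    have h8 : (α r - 1) / 4 ≤ 1 - (α r ^ 2)⁻¹ := by
      have : (1 - (α r ^ 2)⁻¹) = (α r - 1) * ((α r + 1) / α r ^ 2) := by
        field_simp
        ring
      rw [this, div_eq_mul_one_div]
      refine mul_le_mul_of_nonneg_left ?_ (by linarith)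
      rw [div_le_div_iff₀ (by norm_num) (by positivity)]
      nlinarith
    rw [h4]
    linarith

/-- Factor `α² - 1 = (α - 1) (α + 1)`. This converts closeness of `r` to `0` into closeness of `q`
to `1`. -/
theorem exists_profile_upper_bound (hsmooth : ContDiff ℝ ∞ α)
    (hzero : (fun r : ℝ => α r - (1 + r ^ (2 * n) / 2)) =O[𝓝 0] fun r : ℝ => r ^ (2 * n + 1))
    (R : ℝ) :
    ∃ C : ℝ, 0 < C ∧ ∀ r, |r| ≤ R → α r ^ 2 - 1 ≤ C * |r| ^ (2 * n) := by
  have hα := hsmooth.continuous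
  refine exists_le_pow_on_compact (by fun_prop) ?_ R
  have h1 : (fun r => α r - 1) =O[𝓝 0] fun r : ℝ => r ^ (2 * n) := by
    have h2 := (hzero.trans_isLittleO (isLittleO_pow_pow (show 2 * n < 2 * n + 1 by omega))).isBigO
    have h3 : (fun r : ℝ => (1 / 2 : ℝ) * r ^ (2 * n)) =O[𝓝 0] fun r : ℝ => r ^ (2 * n) :=
      isBigO_const_mul_self _ _ _
    exact (h2.add h3).congr_left fun r => by ring
  have h4 : (fun r => α r + 1) =O[𝓝 0] fun _ : ℝ => (1 : ℝ) :=
    (hα.add continuous_const).continuousAt.tendsto.isBigO_one ℝ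
  exact (h1.mul h4).congr (fun r => by ring) fun r => by ring

end Profile

end

/-! ### Radial motion: escape and convexity -/

section

open Filter

/-- The equations of motion of the coordinates `r` and `v = ρ / p` along a trajectory: the second
derivative of `r` is `q α'(r) α(r)⁻³` with `q = p₀ / p²`, and the energy is `1`. -/
structure IsRadialMotion (α : ℝ → ℝ) (q : ℝ) (r v : ℝ → ℝ) : Prop where
  nonneg : 0 ≤ q
  hasDerivAt_pos : ∀ t, HasDerivAt r (v t) t
  hasDerivAt_vel : ∀ t, HasDerivAt v (q * (deriv α (r t) / α (r t) ^ 3)) t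
  energy : ∀ t, v t ^ 2 + (α (r t) ^ 2)⁻¹ * q = 1

namespace IsRadialMotion

variable {α : ℝ → ℝ} {q : ℝ} {r v : ℝ → ℝ}

theorem shift (h : IsRadialMotion α q r v) (a : ℝ) :
    IsRadialMotion α q (fun t => r (t + a)) fun t => v (t + a) where
  nonneg := h.nonneg
  hasDerivAt_pos t := (h.hasDerivAt_pos (t + a)).comp_add_const t a
  hasDerivAt_vel t := (h.hasDerivAt_vel (t + a)).comp_add_const t a
  energy t := h.energy (t + a)

theorem reverse (h : IsRadialMotion α q r v) :
    IsRadialMotion α q (fun t => r (-t)) fun t => -v (-t) where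
  nonneg := h.nonneg
  hasDerivAt_pos t := by
    simpa [Function.comp_def] using (h.hasDerivAt_pos (-t)).scomp t (hasDerivAt_neg t)
  hasDerivAt_vel t := by
    simpa [Function.comp_def] using ((h.hasDerivAt_vel (-t)).scomp t (hasDerivAt_neg t)).fun_neg
  energy t := by simpa using h.energy (-t)

theorem continuous_pos (h : IsRadialMotion α q r v) : Continuous r :=
  continuous_iff_continuousAt.2 fun s => (h.hasDerivAt_pos s).continuousAt

theorem force_nonneg (hpos : ∀ r, 0 < α r) (hmono : ∀ r : ℝ, r ≠ 0 → 0 < r * deriv α r)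
    (h : IsRadialMotion α q r v) (t : ℝ) :
    0 ≤ r t * (q * (deriv α (r t) / α (r t) ^ 3)) := by
  by_cases hr : r t = 0
  · simp [hr]
  · have h1 := hmono _ hr
    have h2 := hpos (r t)
    have h3 := h.nonneg
    have : r t * (q * (deriv α (r t) / α (r t) ^ 3))
      = q * ((r t * deriv α (r t)) / α (r t) ^ 3) := by ring
    rw [this]
    positivity

theorem hasDerivAt_mul (h : IsRadialMotion α q r v) (t : ℝ) :
    HasDerivAt (fun s => r s * v s)
      (v t ^ 2 + r t * (q * (deriv α (r t) / α (r t) ^ 3))) t := by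
  have := (h.hasDerivAt_pos t).mul (h.hasDerivAt_vel t)
  rwa [← sq] at this

theorem hasDerivAt_sq (h : IsRadialMotion α q r v) (t : ℝ) :
    HasDerivAt (fun s => r s ^ 2) (2 * (r t * v t)) t := by
  have := (h.hasDerivAt_pos t).pow 2
  refine this.congr_deriv ?_
  norm_num
  ring

/-- The escape function: its derivative is `v²` plus `r` times a repulsive force. -/
theorem monotone_mul (hpos : ∀ r, 0 < α r) (hmono : ∀ r : ℝ, r ≠ 0 → 0 < r * deriv α r)
    (h : IsRadialMotion α q r v) : Monotone fun s => r s * v s :=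
  monotone_of_hasDerivAt_nonneg h.hasDerivAt_mul fun t => by
    have := h.force_nonneg hpos hmono t
    simp only [Pi.zero_apply]
    positivity

/-- A motion which points away from `r = 0` and is not at rest there escapes to infinity. -/
theorem tendsto_abs_atTop (hpos : ∀ r, 0 < α r)
    (hmono : ∀ r : ℝ, r ≠ 0 → 0 < r * deriv α r) (h : IsRadialMotion α q r v)
    (h0 : 0 ≤ r 0 * v 0) (hne : ¬ (r 0 = 0 ∧ v 0 = 0)) :
    Tendsto (fun t => |r t|) atTop atTop := by
  have hm := h.monotone_mul hpos hmono
  -- If `v 0 = 0`, the energy identity gives `q > 0`, and the force at `r 0 ≠ 0` is strictly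
  -- repulsive.
  have hder : 0 < v 0 ^ 2 + r 0 * (q * (deriv α (r 0) / α (r 0) ^ 3)) := by
    by_cases hv : v 0 = 0
    · have hr : r 0 ≠ 0 := fun hr => hne ⟨hr, hv⟩
      have hq : 0 < q := by
        refine h.nonneg.lt_of_ne fun hq => ?_
        have := h.energy 0
        simp [← hq, hv] at this
      have h1 := hmono _ hr
      have h2 := hpos (r 0)
      have : r 0 * (q * (deriv α (r 0) / α (r 0) ^ 3))
        = q * ((r 0 * deriv α (r 0)) / α (r 0) ^ 3) := by ring
      rw [this]
      positivity
    · have := h.force_nonneg hpos hmono 0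
      positivity
  have hpos1 : ∀ t, 0 < t → 0 < r t * v t := by
    intro t ht
    by_contra! hcon
    have hzero : ∀ᶠ x in 𝓝[>] (0 : ℝ), r x * v x = 0 := by
      filter_upwards [Ioc_mem_nhdsGT ht] with x hx
      exact le_antisymm ((hm hx.2).trans hcon) (h0.trans (hm hx.1.le))
    have h00 : r 0 * v 0 = 0 := le_antisymm ((hm ht.le).trans hcon) h0
    have hd2 : HasDerivWithinAt (fun s => r s * v s) 0 (Set.Ioi 0) 0 :=
      (hasDerivWithinAt_const (0 : ℝ) (Set.Ioi 0) (0 : ℝ)).congr_of_eventuallyEq hzero h00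
    exact hder.ne' ((uniqueDiffWithinAt_Ioi (0 : ℝ)).eq_deriv _
      (h.hasDerivAt_mul 0).hasDerivWithinAt hd2)
  set k := r 1 * v 1 with hk
  have hk0 : 0 < k := hpos1 1 one_pos
  have hrc := h.continuous_pos
  -- From time `1` on, `(r²)' = 2 r v ≥ 2 k`, so `r²` grows at least linearly.
  have hlin : MonotoneOn (fun s => r s ^ 2 - 2 * k * s) (Set.Ici 1) := by
    refine monotoneOn_of_hasDerivWithinAt_nonneg (convex_Ici 1) (by fun_prop)
      (f' := fun s => 2 * (r s * v s) - 2 * k * 1)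
      (fun s _ => ((h.hasDerivAt_sq s).sub
        ((hasDerivAt_id s).const_mul _)).hasDerivWithinAt) fun s hs => ?_
    have h1 : k ≤ r s * v s := hm (interior_subset hs)
    linarith
  suffices hsq : Tendsto (fun t => r t ^ 2) atTop atTop by
    simpa [Function.comp_def, Real.sqrt_sq_eq_abs] using Real.tendsto_sqrt_atTop.comp hsq
  have hlin2 : Tendsto (fun s : ℝ => 2 * k * s + (r 1 ^ 2 - 2 * k)) atTop atTop :=
    tendsto_atTop_add_const_right _ _ (tendsto_id.const_mul_atTop (by positivity))
  refine tendsto_atTop_mono' _ ?_ hlin2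
  filter_upwards [eventually_ge_atTop 1] with s hs
  have := hlin Set.self_mem_Ici hs hs
  simp only [mul_one] at this
  linarith

/-- Between two times, `|r|` does not exceed its values at these times. -/
theorem abs_le (hpos : ∀ r, 0 < α r) (hmono : ∀ r : ℝ, r ≠ 0 → 0 < r * deriv α r)
    (h : IsRadialMotion α q r v) {R t s : ℝ} (h0 : |r 0| ≤ R) (ht : |r t| ≤ R)
    (hs : s ∈ Set.Icc 0 t) : |r s| ≤ R := by
  -- The derivative `2 r v` of `r²` is monotone, and a convex function is bounded by its endpoint
  -- values.
  have hconv : ConvexOn ℝ Set.univ fun s => r s ^ 2 := by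
    have hd : deriv (fun s => r s ^ 2) = fun t => 2 * (r t * v t) :=
      funext fun t => (h.hasDerivAt_sq t).deriv
    refine MonotoneOn.convexOn_of_deriv convex_univ ?_ ?_ ?_
    · exact (h.continuous_pos.pow 2).continuousOn
    · exact fun t _ => (h.hasDerivAt_sq t).differentiableAt.differentiableWithinAt
    · rw [hd]
      exact ((h.monotone_mul hpos hmono).const_mul zero_le_two).monotoneOn _
  have hR : 0 ≤ R := (abs_nonneg _).trans h0
  have h1 := hconv.le_max_of_mem_Icc (Set.mem_univ 0) (Set.mem_univ t) hs
  refine abs_le_of_sq_le_sq (h1.trans (max_le ?_ ?_)) hR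
  · exact sq_le_sq' (_root_.abs_le.1 h0).1 (_root_.abs_le.1 h0).2
  · exact sq_le_sq' (_root_.abs_le.1 ht).1 (_root_.abs_le.1 ht).2

end IsRadialMotion

/-! ### The differential of the Hamiltonian -/

section Hamilton

variable {d : ℕ} {α : ℝ → ℝ}

theorem pSq_pos (hpos : ∀ r, 0 < α r) {x : Phase d} (hx : x ∈ cotangent d) :
    0 < radialMomentum x ^ 2 + (α (radius x) ^ 2)⁻¹ * p₀ x := by
  have h1 := hpos (radius x)
  by_cases hρ : radialMomentum x = 0
  · have h2 : angularMomentum x ≠ 0 := fun h => hx.2.2 (by simp [hρ, h])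
    have : 0 < p₀ x := by unfold p₀; positivity
    positivity
  · have : 0 ≤ p₀ x := by unfold p₀; positivity
    positivity

theorem p_pos (hpos : ∀ r, 0 < α r) {x : Phase d} (hx : x ∈ cotangent d) : 0 < p α x :=
  Real.sqrt_pos.2 (pSq_pos hpos hx)

theorem p_sq (hpos : ∀ r, 0 < α r) {x : Phase d} (hx : x ∈ cotangent d) :
    p α x ^ 2 = radialMomentum x ^ 2 + (α (radius x) ^ 2)⁻¹ * p₀ x :=
  Real.sq_sqrt (pSq_pos hpos hx).le

/-- The differential of `p`. -/
theorem fderiv_p (hd : Differentiable ℝ α) (hpos : ∀ r, 0 < α r) {x : Phase d}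
    (hx : x ∈ cotangent d) :
    DifferentiableAt ℝ (p α) x ∧ ∀ v : Phase d, fderiv ℝ (p α) x v =
      (radialMomentum x * radialMomentum v
        + (α (radius x) ^ 2)⁻¹ * inner ℝ (angularMomentum x) (angularMomentum v)
        - deriv α (radius x) / α (radius x) ^ 3 * p₀ x * radius v) / p α x := by
  have hne := (pSq_pos hpos hx).ne'
  have hα0 : ∀ r, α r ^ 2 ≠ 0 := fun r => (pow_pos (hpos r) 2).ne'
  have hdiff : DifferentiableAt ℝ (p α) x := by
    have h1 : Differentiable ℝ fun x : Phase d => (α (radius x) ^ 2)⁻¹ := by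
      have h2 : Differentiable ℝ fun x : Phase d => α (radius x) := hd.comp differentiable_fst
      exact (h2.pow 2).inv fun x => hα0 _
    have h3 : Differentiable ℝ (p₀ : Phase d → ℝ) :=
      (show Differentiable ℝ fun x : Phase d => angularMomentum x by
        unfold angularMomentum; fun_prop).norm_sq ℝ
    have h4 : Differentiable ℝ (radialMomentum : Phase d → ℝ) := by
      unfold radialMomentum; fun_prop
    exact (((h4.pow 2).add (h1.mul h3)) x).sqrt hne
  refine ⟨hdiff, fun v => ?_⟩
  have hline : HasDerivAt (fun s : ℝ => p α (x + s • v)) (fderiv ℝ (p α) x v) 0 :=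
    hdiff.hasFDerivAt.hasLineDerivAt v
  refine hline.unique ?_
  have hr : HasDerivAt (fun s : ℝ => radius x + s * radius v) (radius v) 0 := by
    simpa using ((hasDerivAt_id (0 : ℝ)).mul_const (radius v)).const_add (radius x)
  have hρ : HasDerivAt (fun s : ℝ => radialMomentum x + s * radialMomentum v)
      (radialMomentum v) 0 := by
    simpa using ((hasDerivAt_id (0 : ℝ)).mul_const (radialMomentum v)).const_add (radialMomentum x)
  have hη : HasDerivAt (fun s : ℝ => angularMomentum x + s • angularMomentum v)
      (angularMomentum v) 0 := by
    simpa using ((hasDerivAt_id (0 : ℝ)).smul_const (angularMomentum v)).const_add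
      (angularMomentum x)
  have hα : HasDerivAt (fun s : ℝ => α (radius x + s * radius v))
      (deriv α (radius x) * radius v) 0 := by
    have h1 : HasDerivAt α (deriv α (radius x)) (radius x + 0 * radius v) := by
      simpa using (hd (radius x)).hasDerivAt
    exact h1.comp 0 hr
  have hinv := (hα.fun_pow 2).fun_inv (by simpa using hα0 (radius x))
  have hsum := (hρ.fun_pow 2).fun_add (hinv.fun_mul hη.norm_sq)
  have hsqrt := hsum.sqrt (by simpa [p₀] using hne)
  refine hsqrt.congr_deriv ?_
  have hP : √((radialMomentum x + 0 * radialMomentum v) ^ 2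
      + (α (radius x + 0 * radius v) ^ 2)⁻¹
        * ‖angularMomentum x + (0 : ℝ) • angularMomentum v‖ ^ 2) = p α x := by
    simp [p, p₀]
  rw [hP]
  have := p_pos hpos hx
  have := hpos (radius x)
  simp only [zero_mul, add_zero, zero_smul, p₀]
  field_simp
  norm_num
  ring

end Hamilton

end

/-! ### The decay scale and quantitative escape -/

section

open Filter

/-- The distance `t^(-1/(n-1))` from the trapped set at which trajectories linger for time `t`. -/
noncomputable def scale (n : ℕ) (t : ℝ) : ℝ := t ^ (-(1 / ((n : ℝ) - 1)))

section Scale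

variable {n : ℕ} {t : ℝ}

theorem scale_pos (ht : 0 < t) : 0 < scale n t := Real.rpow_pos_of_pos ht _

theorem scale_pow (ht : 0 < t) (k : ℕ) : scale n t ^ k = t ^ (-((k : ℝ) / ((n : ℝ) - 1))) := by
  rw [scale, ← Real.rpow_mul_natCast ht.le]
  congr 1
  ring

theorem scale_pow_pred (m : ℕ) (ht : 0 < t) : scale (m + 2) t ^ (m + 1) = t⁻¹ := by
  rw [scale_pow ht, ← Real.rpow_neg_one]
  congr 1
  push_cast
  have : (m : ℝ) + 1 ≠ 0 := by positivity
  rw [show (m : ℝ) + 2 - 1 = m + 1 by ring, div_self this]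

/-- The exponent `1 / (n - 1)` is at most `1`. The midpoint argument only follows a motion for time
`t / 2`. -/
theorem scale_half_le (hn : 2 ≤ n) (ht : 0 < t) : scale n (t / 2) ≤ 2 * scale n t := by
  have hn' : (2 : ℝ) ≤ n := by exact_mod_cast hn
  have h1 : 1 / ((n : ℝ) - 1) ≤ 1 := by
    rw [div_le_one (by linarith)]; linarith
  unfold scale
  rw [div_eq_mul_inv, Real.mul_rpow ht.le (by norm_num), Real.inv_rpow zero_le_two,
    Real.rpow_neg zero_le_two, inv_inv, mul_comm]
  gcongr
  calc (2 : ℝ) ^ (1 / ((n : ℝ) - 1)) ≤ 2 ^ (1 : ℝ) :=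
        Real.rpow_le_rpow_of_exponent_le one_le_two h1
    _ = 2 := Real.rpow_one 2

/-- Turns a lifespan bound into a decay bound; `1 ≤ C` gives `C ≤ C^(m+1)`, so taking the root
leaves the constant unchanged. -/
theorem le_mul_scale (m : ℕ) {C a : ℝ} (hC : 1 ≤ C) (ht : 0 < t)
    (h : t * a ^ (m + 1) ≤ C) : a ≤ C * scale (m + 2) t := by
  have hs := scale_pos (n := m + 2) ht
  refine le_of_pow_le_pow_left₀ (n := m + 1) (by omega) (by positivity) ?_
  rw [mul_pow, scale_pow_pred m ht, ← div_eq_mul_inv, le_div_iff₀ ht, mul_comm]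
  exact h.trans (le_self_pow₀ hC (by omega))

end Scale

/-- A solution moving away from `0` under a repulsive force of size at least `c r^(2n-1)` for a time
`t` must have started within `scale n t` of the rest point. -/
theorem decay_of_repulsive {n : ℕ} (hn : 2 ≤ n) {c : ℝ} (hc : 0 < c) :
    ∃ C : ℝ, 0 < C ∧ ∀ (r v g : ℝ → ℝ) (t R : ℝ),
      (∀ s, HasDerivAt r (v s) s) → (∀ s, HasDerivAt v (g s) s) → (∀ s, 0 ≤ r s * g s) →
      (∀ s, 0 ≤ r s → r s ≤ R → c * r s ^ (2 * n - 1) ≤ g s) →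
      0 ≤ r 0 → 0 ≤ v 0 → 0 < t → r t ≤ R →
      r 0 ≤ C * scale n t ∧ v 0 ≤ C * scale n t ^ n := by
  obtain ⟨m, rfl⟩ : ∃ m, n = m + 2 := ⟨n - 2, by omega⟩
  obtain ⟨C₁, hC₁, h₁⟩ := lifespan_le_of_position m hc
  obtain ⟨C₂, hC₂, h₂⟩ := lifespan_le_of_velocity m hc
  refine ⟨C₁ + C₂ ^ (m + 2), by positivity, fun r v g t R hr hv hrg hg hr0 hv0 ht hrt => ?_⟩
  have hs := scale_pos (n := m + 2) ht
  have hs' : 0 ≤ C₂ ^ (m + 2) := by positivity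
  by_cases hne : r 0 = 0 ∧ v 0 = 0
  · rw [hne.1, hne.2]
    constructor <;> positivity
  have hnn : ∀ s, 0 ≤ s → 0 ≤ r s ∧ 0 ≤ v s := fun s hs =>
    nonneg_of_repulsive hr hv hrg hr0 hv0 hne hs
  have hmono : MonotoneOn r (Set.Ici 0) :=
    monotoneOn_of_hasDerivWithinAt_nonneg (convex_Ici 0)
      (fun s _ => (hr s).continuousAt.continuousWithinAt)
      (fun s _ => (hr s).hasDerivWithinAt) fun s hs => (hnn s (interior_subset hs)).2
  have H : ∀ s ∈ Set.Icc 0 t, 0 ≤ r s ∧ 0 ≤ v s ∧ c * r s ^ (2 * m + 3) ≤ g s := by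
    intro s hs
    refine ⟨(hnn s hs.1).1, (hnn s hs.1).2, hg s (hnn s hs.1).1 ?_⟩
    exact (hmono hs.1 ht.le hs.2).trans hrt
  constructor
  · rcases hr0.eq_or_lt with h0 | h0
    · rw [← h0]; positivity
    · have := le_mul_scale m hC₁ ht (h₁ r v g t hr hv H h0 ht.le)
      calc r 0 ≤ C₁ * scale (m + 2) t := this
        _ ≤ _ := by gcongr; linarith
  · rcases hv0.eq_or_lt with h0 | h0
    · rw [← h0]; positivity
    -- The velocity bound is used with `a = v(0)^(1/n)`, where `n = m + 2`.
    · have hroot : (v 0 ^ (((m + 2 : ℕ) : ℝ)⁻¹)) ^ (m + 2) = v 0 :=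
        Real.rpow_inv_natCast_pow hv0 (by omega)
      have h3 := le_mul_scale m hC₂ ht
        (h₂ r v g t (v 0 ^ (((m + 2 : ℕ) : ℝ)⁻¹)) hr hv H (Real.rpow_pos_of_pos h0 _)
          hroot.le ht.le)
      calc v 0 = (v 0 ^ (((m + 2 : ℕ) : ℝ)⁻¹)) ^ (m + 2) := hroot.symm
        _ ≤ (C₂ * scale (m + 2) t) ^ (m + 2) :=
            pow_le_pow_left₀ (Real.rpow_nonneg hv0 _) h3 _
        _ = C₂ ^ (m + 2) * scale (m + 2) t ^ (m + 2) := mul_pow _ _ _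
        _ ≤ _ := by gcongr; linarith

section Radial

variable {n : ℕ} {α : ℝ → ℝ}

/-- A motion which moves away from `r = 0` and is still at `|r| ≤ R` at time `t` started within
`scale n t` of `r = 0`. -/
theorem exists_decay_bound (hn : 2 ≤ n) (hsmooth : ContDiff ℝ ∞ α) (hpos : ∀ r, 0 < α r)
    (hzero : (fun r : ℝ => α r - (1 + r ^ (2 * n) / 2)) =O[𝓝 0] fun r : ℝ => r ^ (2 * n + 1))
    (hmono : ∀ r : ℝ, r ≠ 0 → 0 < r * deriv α r) (R : ℝ) :
    ∃ C : ℝ, 0 < C ∧ ∀ (q : ℝ) (r v : ℝ → ℝ) (t : ℝ), IsRadialMotion α q r v → 1 / 2 ≤ q →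
      0 < t → |r t| ≤ R → 0 ≤ r 0 * v 0 →
      |r 0| ≤ C * scale n t ∧ |v 0| ≤ C * scale n t ^ n := by
  obtain ⟨c, hc, hforce⟩ := exists_force_lower_bound hn hsmooth hpos hzero hmono R
  obtain ⟨C, hC, H⟩ := decay_of_repulsive hn (show 0 < 1 / 2 * c by positivity)
  refine ⟨C, hC, fun q r v t h hq ht hrt h0 => ?_⟩
  have hd0 := deriv_profile_zero hsmooth hmono
  have hup : ∀ x, 0 ≤ x → x ≤ R → 1 / 2 * c * x ^ (2 * n - 1)
      ≤ q * (deriv α x / α x ^ 3) := by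
    intro x hx hxR
    rcases hx.eq_or_lt with rfl | hx
    · simp [hd0, show 2 * n - 1 ≠ 0 by omega]
    · have h1 := hforce x (by rwa [abs_of_pos hx])
      rw [abs_of_pos hx, show 2 * n = (2 * n - 1) + 1 by omega, pow_succ] at h1
      have h2 : c * x ^ (2 * n - 1) ≤ deriv α x / α x ^ 3 := by
        refine le_of_mul_le_mul_left ?_ hx
        linarith
      have h3 : 0 ≤ c * x ^ (2 * n - 1) := by positivity
      nlinarith
  -- The profile need not be even, so the force is estimated separately on the left; the motion is
  -- then reflected.
  have hdown : ∀ x, x ≤ 0 → -x ≤ R → 1 / 2 * c * (-x) ^ (2 * n - 1)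
      ≤ -(q * (deriv α x / α x ^ 3)) := by
    intro x hx hxR
    rcases hx.eq_or_lt with rfl | hx
    · simp [hd0, show 2 * n - 1 ≠ 0 by omega]
    · have hx' : 0 < -x := by linarith
      have h1 := hforce x (by rwa [abs_of_neg hx])
      rw [abs_of_neg hx, show 2 * n = (2 * n - 1) + 1 by omega, pow_succ] at h1
      have h2 : c * (-x) ^ (2 * n - 1) ≤ -(deriv α x / α x ^ 3) := by
        refine le_of_mul_le_mul_left ?_ hx'
        linarith
      have h3 : 0 ≤ c * (-x) ^ (2 * n - 1) := by positivity
      nlinarith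
  have hfn := h.force_nonneg hpos hmono
  have hcase : (0 ≤ r 0 ∧ 0 ≤ v 0) ∨ (r 0 ≤ 0 ∧ v 0 ≤ 0) := by
    exact mul_nonneg_iff.1 h0
  rcases hcase with ⟨hr0, hv0⟩ | ⟨hr0, hv0⟩
  · rw [abs_of_nonneg hr0, abs_of_nonneg hv0]
    exact H r v _ t R h.hasDerivAt_pos h.hasDerivAt_vel hfn (fun s => hup (r s)) hr0 hv0 ht
      ((le_abs_self _).trans hrt)
  · rw [abs_of_nonpos hr0, abs_of_nonpos hv0]
    exact H (fun s => -r s) (fun s => -v s) (fun s => -(q * (deriv α (r s) / α (r s) ^ 3))) t R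
      (fun s => (h.hasDerivAt_pos s).fun_neg) (fun s => (h.hasDerivAt_vel s).fun_neg)
      (fun s => by simpa using hfn s) (fun s hs => hdown (r s) (by linarith)) (by linarith)
      (by linarith) ht ((neg_le_abs _).trans hrt)

/-- A motion which is at `|r| ≤ R` at the times `0` and `t` has nearly critical angular momentum. -/
theorem exists_momentum_bound (hn : 2 ≤ n) (hsmooth : ContDiff ℝ ∞ α) (hpos : ∀ r, 0 < α r)
    (hzero : (fun r : ℝ => α r - (1 + r ^ (2 * n) / 2)) =O[𝓝 0] fun r : ℝ => r ^ (2 * n + 1))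
    (hmono : ∀ r : ℝ, r ≠ 0 → 0 < r * deriv α r) {R : ℝ} (hR : 0 ≤ R) :
    ∃ K : ℝ, 0 < K ∧ ∀ (q : ℝ) (r v : ℝ → ℝ) (t : ℝ), IsRadialMotion α q r v → 4 * R < t →
      |r 0| ≤ R → |r t| ≤ R → |q - 1| ≤ K * scale n t ^ (2 * n) := by
  obtain ⟨C, hC, H⟩ := exists_decay_bound hn hsmooth hpos hzero hmono R
  obtain ⟨D, hD, hup⟩ := exists_profile_upper_bound hsmooth hzero R
  have hone := one_le_profile hsmooth hmono (profile_zero hzero hn)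
  refine ⟨(D * C ^ (2 * n) + C ^ 2) * 2 ^ (2 * n), by positivity,
    fun q r v t h ht h0 hrt => ?_⟩
  have htpos : 0 < t := by linarith
  have hbound := fun s => h.abs_le hpos hmono (s := s) h0 hrt
  -- Otherwise `v² ≥ 1 / 2` throughout, so `r v` grows at rate at least `1 / 2` while staying in
  -- `[-R, R]` at both ends; this forces `t ≤ 4 R`.
  have hq : 1 / 2 ≤ q := by
    by_contra! hq
    have hv : ∀ s, 1 / 2 ≤ v s ^ 2 ∧ |v s| ≤ 1 := by
      intro s
      have h1 := h.energy s
      have h2 := hone (r s)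
      have h3 : (α (r s) ^ 2)⁻¹ ≤ 1 := inv_le_one_of_one_le₀ (by nlinarith)
      have h4 : 0 ≤ (α (r s) ^ 2)⁻¹ := by positivity
      have h5 := h.nonneg
      refine ⟨by nlinarith, abs_le_of_sq_le_sq (by nlinarith) zero_le_one⟩
    have hm : Monotone fun s => r s * v s - 1 / 2 * s :=
      monotone_of_hasDerivAt_nonneg
        (fun s => (h.hasDerivAt_mul s).fun_sub ((hasDerivAt_id s).const_mul _)) fun s => by
          have h1 := h.force_nonneg hpos hmono s
          have h2 := (hv s).1
          simp only [Pi.zero_apply]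
          linarith
    have h1 := hm htpos.le
    have h2 : ∀ s, |r s| ≤ R → |r s * v s| ≤ R := fun s hs => by
      rw [abs_mul]
      calc |r s| * |v s| ≤ R * 1 := by
            gcongr
            exact (hv s).2
        _ = R := mul_one R
    have h3 := (abs_le.1 (h2 0 h0)).1
    have h4 := (abs_le.1 (h2 t hrt)).2
    simp only [mul_zero, sub_zero] at h1
    linarith
  -- From the midpoint, either the motion or its time reversal is outward, and it is within `R`
  -- after time `t / 2`.
  have hmid : |r (t / 2)| ≤ C * scale n (t / 2) ∧ |v (t / 2)| ≤ C * scale n (t / 2) ^ n := by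
    rcases le_total 0 (r (t / 2) * v (t / 2)) with hs | hs
    · simpa using H q _ _ (t / 2) (h.shift (t / 2)) hq (by positivity) (by simpa using hrt)
        (by simpa using hs)
    · simpa using H q _ _ (t / 2) (h.shift (t / 2)).reverse hq (by positivity)
        (by simpa using h0) (by simpa using hs)
  have hsc := scale_half_le hn htpos
  have hsp := scale_pos (n := n) htpos
  have hsp2 := scale_pos (n := n) (show 0 < t / 2 by positivity)
  have hr2 := hbound (t / 2) ⟨by positivity, by linarith⟩
  have hen := h.energy (t / 2)
  have hone2 := hone (r (t / 2))
  set x := r (t / 2)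
  set w := v (t / 2)
  -- As `α² ≥ 1` and `w² ≤ 1`, this gives `-w² ≤ q - 1 ≤ α² - 1`.
  have hq2 : q = α x ^ 2 * (1 - w ^ 2) := by
    rw [← hen]
    field_simp
    ring
  have hw1 : w ^ 2 ≤ 1 := by
    have : 0 ≤ (α x ^ 2)⁻¹ * q := mul_nonneg (by positivity) h.nonneg
    linarith
  have hsq : 1 ≤ α x ^ 2 := by nlinarith
  have e1 : α x ^ 2 - 1 ≤ D * C ^ (2 * n) * 2 ^ (2 * n) * scale n t ^ (2 * n) := by
    calc α x ^ 2 - 1 ≤ D * |x| ^ (2 * n) := hup x hr2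
      _ ≤ D * (C * (2 * scale n t)) ^ (2 * n) := by
          gcongr
          exact hmid.1.trans (by gcongr)
      _ = _ := by ring
  have e2 : w ^ 2 ≤ C ^ 2 * 2 ^ (2 * n) * scale n t ^ (2 * n) := by
    calc w ^ 2 = |w| ^ 2 := (sq_abs w).symm
      _ ≤ (C * (2 * scale n t) ^ n) ^ 2 := by
          gcongr
          exact hmid.2.trans (by gcongr)
      _ = _ := by ring
  have e3 : 0 ≤ C ^ 2 * 2 ^ (2 * n) * scale n t ^ (2 * n) := by positivity
  have e4 : 0 ≤ D * C ^ (2 * n) * 2 ^ (2 * n) * scale n t ^ (2 * n) := by positivity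
  rw [abs_le]
  constructor
  · nlinarith
  · nlinarith [sq_nonneg w]

end Radial

/-! ### Conservation laws, reduction to radial motion and the trapped set -/

section Trajectory

variable {d : ℕ} {α : ℝ → ℝ}

theorem IsHamiltonVector.radius_eq (hd : Differentiable ℝ α) (hpos : ∀ r, 0 < α r)
    {x X : Phase d} (hx : x ∈ cotangent d) (h : IsHamiltonVector α x X) :
    radius X = radialMomentum x / p α x := by
  have h1 := h.2 (0, 0, 1, 0) (by simp [tangentAt, angle, angularMomentum])
  rw [(fderiv_p hd hpos hx).2] at h1
  simpa [symplectic, angle, angularMomentum, radius, radialMomentum] using h1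

theorem IsHamiltonVector.radialMomentum_eq (hd : Differentiable ℝ α) (hpos : ∀ r, 0 < α r)
    {x X : Phase d} (hx : x ∈ cotangent d) (h : IsHamiltonVector α x X) :
    radialMomentum X = deriv α (radius x) / α (radius x) ^ 3 * p₀ x / p α x := by
  have h1 := h.2 (1, 0, 0, 0) (by simp [tangentAt, angle, angularMomentum])
  rw [(fderiv_p hd hpos hx).2] at h1
  simp [symplectic, angle, angularMomentum, radius, radialMomentum] at h1
  rw [neg_div, neg_inj] at h1
  exact h1

/-- The test vector generates the great-circle motion of `(θ, η)`: it is tangent to `T^*M` and `dp`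
vanishes on it. The conservation of `p₀` follows. -/
theorem IsHamiltonVector.inner_angularMomentum (hd : Differentiable ℝ α) (hpos : ∀ r, 0 < α r)
    {x X : Phase d} (hx : x ∈ cotangent d) (h : IsHamiltonVector α x X) :
    inner ℝ (angularMomentum x) (angularMomentum X) = 0 := by
  have hθη := hx.2.1
  have h1 := h.2 (0, angularMomentum x, 0, -(‖angularMomentum x‖ ^ 2) • angle x) (by
    have h3 := hx.1
    have h2 : inner ℝ x.2.1 x.2.2.2 = 0 := hθη
    have h4 : ‖x.2.1‖ = 1 := h3
    simp [tangentAt, angle, angularMomentum, h2, inner_smul_right, h4])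
  rw [(fderiv_p hd hpos hx).2] at h1
  have h2 : inner ℝ (angle X) (angle x) = 0 := by rw [real_inner_comm]; exact h.1.1
  have h5 : inner ℝ (angularMomentum x) (angle x) = 0 := by rw [real_inner_comm]; exact hθη
  simp only [symplectic, angle, angularMomentum, radius, radialMomentum, inner_smul_right] at h1 h2 h5 ⊢
  rw [real_inner_comm]
  simpa [h2, h5] using h1

namespace IsTrajectory

variable {γ : ℝ → Phase d}

theorem hasDerivAt_p (hd : Differentiable ℝ α) (hpos : ∀ r, 0 < α r) (h : IsTrajectory α γ)
    (t : ℝ) : HasDerivAt (fun s => p α (γ s)) 0 t := by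
  obtain ⟨hx, X, hX, hγ⟩ := h t
  have h1 := (fderiv_p hd hpos hx).1.hasFDerivAt.comp_hasDerivAt t hγ
  refine h1.congr_deriv ?_
  rw [← hX.2 X hX.1]
  simp only [symplectic, real_inner_comm (angle X)]
  ring

theorem p_eq (hd : Differentiable ℝ α) (hpos : ∀ r, 0 < α r) (h : IsTrajectory α γ) (t : ℝ) :
    p α (γ t) = p α (γ 0) :=
  is_const_of_deriv_eq_zero (f := fun s => p α (γ s))
    (fun t => (h.hasDerivAt_p hd hpos t).differentiableAt)
    (fun t => (h.hasDerivAt_p hd hpos t).deriv) t 0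

theorem hasDerivAt_angularMomentum {X : Phase d} {t : ℝ} (hγ : HasDerivAt γ X t) :
    HasDerivAt (fun s => angularMomentum (γ s)) (angularMomentum X) t := by
  have := hγ.hasFDerivAt.snd.snd.snd.hasDerivAt
  simpa [angularMomentum] using this

theorem hasDerivAt_p₀ (hd : Differentiable ℝ α) (hpos : ∀ r, 0 < α r) (h : IsTrajectory α γ)
    (t : ℝ) : HasDerivAt (fun s => p₀ (γ s)) 0 t := by
  obtain ⟨hx, X, hX, hγ⟩ := h t
  refine (hasDerivAt_angularMomentum hγ).norm_sq.congr_deriv ?_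
  rw [hX.inner_angularMomentum hd hpos hx, mul_zero]

theorem p₀_eq (hd : Differentiable ℝ α) (hpos : ∀ r, 0 < α r) (h : IsTrajectory α γ) (t : ℝ) :
    p₀ (γ t) = p₀ (γ 0) :=
  is_const_of_deriv_eq_zero (f := fun s => p₀ (γ s))
    (fun t => (h.hasDerivAt_p₀ hd hpos t).differentiableAt)
    (fun t => (h.hasDerivAt_p₀ hd hpos t).deriv) t 0

/-- The radial part of a trajectory. -/
theorem isRadialMotion (hd : Differentiable ℝ α) (hpos : ∀ r, 0 < α r) (h : IsTrajectory α γ) :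
    IsRadialMotion α (p₀ (γ 0) / p α (γ 0) ^ 2) (fun t => radius (γ t))
      fun t => radialMomentum (γ t) / p α (γ 0) where
  nonneg := by unfold p₀; positivity
  hasDerivAt_pos t := by
    obtain ⟨hx, X, hX, hγ⟩ := h t
    have h1 := hγ.hasFDerivAt.fst.hasDerivAt
    rw [← h.p_eq hd hpos t, ← hX.radius_eq hd hpos hx]
    simpa [radius] using h1
  hasDerivAt_vel t := by
    obtain ⟨hx, X, hX, hγ⟩ := h t
    have h1 := hγ.hasFDerivAt.snd.snd.fst.hasDerivAt
    have h2 : HasDerivAt (fun s => radialMomentum (γ s)) (radialMomentum X) t := by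
      simpa [radialMomentum] using h1
    refine (h2.div_const _).congr_deriv ?_
    rw [hX.radialMomentum_eq hd hpos hx, h.p_eq hd hpos t, h.p₀_eq hd hpos t]
    have := p_pos hpos (h 0).1
    field_simp
  energy t := by
    have h1 := p_sq hpos (h t).1
    rw [h.p_eq hd hpos t, h.p₀_eq hd hpos t] at h1
    have := p_pos hpos (h 0).1
    rw [div_pow, ← mul_div_assoc, ← add_div, ← h1, div_self (by positivity)]

end IsTrajectory

/-- The great circles over `r = 0` are trajectories. -/
theorem exists_trajectory_of_radius_eq_zero (hd : Differentiable ℝ α) (hpos : ∀ r, 0 < α r)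
    (h0 : α 0 = 1) (hd0 : deriv α 0 = 0) {x : Phase d} (hx : x ∈ cotangent d)
    (hr : radius x = 0) (hρ : radialMomentum x = 0) :
    ∃ γ, IsTrajectory α γ ∧ γ 0 = x ∧ ∀ t, radius (γ t) = 0 := by
  obtain ⟨r, θ, ρ, η⟩ := x
  obtain ⟨hθ, hθη, hne⟩ := hx
  simp only [radius, radialMomentum, angle, angularMomentum] at hr hρ hθ hθη hne
  subst hr hρ
  have hη : 0 < ‖η‖ := norm_pos_iff.2 fun h => hne (by simp [h])
  -- `θ` and `e` are orthonormal; rotating them in their plane at unit speed gives the great circle,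
  -- since `p = ‖η‖` where `α = 1`.
  set e : E d := ‖η‖⁻¹ • η with he
  have hηe : η = ‖η‖ • e := by rw [he, smul_smul, mul_inv_cancel₀ hη.ne', one_smul]
  have hen : ‖e‖ = 1 := by
    rw [he, norm_smul, norm_inv, norm_norm, inv_mul_cancel₀ hη.ne']
  have hθe : inner ℝ θ e = 0 := by rw [he, inner_smul_right, hθη, mul_zero]
  have heθ : inner ℝ e θ = 0 := by rw [real_inner_comm, hθe]
  have hθθ : inner ℝ θ θ = 1 := by rw [real_inner_self_eq_norm_sq, hθ, one_pow]
  have hee : inner ℝ e e = 1 := by rw [real_inner_self_eq_norm_sq, hen, one_pow]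
  set a : ℝ → E d := fun t => Real.cos t • θ + Real.sin t • e with ha
  set b : ℝ → E d := fun t => (-Real.sin t) • θ + Real.cos t • e with hb
  have hda : ∀ t, HasDerivAt a (b t) t := fun t =>
    ((Real.hasDerivAt_cos t).smul_const θ).add ((Real.hasDerivAt_sin t).smul_const e)
  have hdb : ∀ t, HasDerivAt b (-a t) t := fun t => by
    refine (((Real.hasDerivAt_sin t).fun_neg.smul_const θ).add
      ((Real.hasDerivAt_cos t).smul_const e)).congr_deriv ?_
    simp only [ha]
    module
  have haa : ∀ t, inner ℝ (a t) (a t) = 1 := fun t => by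
    simp only [ha, inner_add_left, inner_add_right, inner_smul_left, inner_smul_right, hθe, heθ,
      hθθ, hee]
    simp
    linear_combination Real.cos_sq_add_sin_sq t
  have hbb : ∀ t, inner ℝ (b t) (b t) = 1 := fun t => by
    simp only [hb, inner_add_left, inner_add_right, inner_smul_left, inner_smul_right, hθe, heθ,
      hθθ, hee]
    simp
    linear_combination Real.cos_sq_add_sin_sq t
  have hab : ∀ t, inner ℝ (a t) (b t) = 0 := fun t => by
    simp only [ha, hb, inner_add_left, inner_add_right, inner_smul_left, inner_smul_right, hθe,
      heθ, hθθ, hee]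
    simp
    ring
  have hbn : ∀ t, ‖b t‖ = 1 := fun t => by
    rw [norm_eq_sqrt_real_inner, hbb, Real.sqrt_one]
  have hmem : ∀ t, ((0, a t, 0, ‖η‖ • b t) : Phase d) ∈ cotangent d := fun t => by
    refine ⟨?_, ?_, ?_⟩
    · simp only [angle]; rw [norm_eq_sqrt_real_inner, haa, Real.sqrt_one]
    · simp only [angle, angularMomentum, inner_smul_right, hab, mul_zero]
    · intro h
      have h2 : ‖η‖ • b t = 0 := congrArg Prod.snd h
      have h3 := congrArg norm h2
      rw [norm_smul, hbn, norm_norm, norm_zero, mul_one] at h3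
      exact hη.ne' h3
  refine ⟨fun t => (0, a t, 0, ‖η‖ • b t), fun t => ⟨hmem t, (0, b t, 0, -‖η‖ • a t), ⟨⟨?_, ?_⟩,
    ?_⟩, ?_⟩, ?_, fun t => rfl⟩
  · simpa [angle] using hab t
  · simp only [angle, angularMomentum, inner_smul_right, haa, hbb]
    ring
  · intro v hv
    rw [(fderiv_p hd hpos (hmem t)).2]
    have hp : p α ((0, a t, 0, ‖η‖ • b t) : Phase d) = ‖η‖ := by
      simp [p, p₀, radialMomentum, radius, angularMomentum, h0, norm_smul, hbn]
    have hv1 : inner ℝ (a t) (angle v) = 0 := hv.1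
    simp only [hp, symplectic, radius, radialMomentum, angle, angularMomentum, h0, hd0,
      inner_smul_left] at hv1 ⊢
    simp [hv1]
    field_simp
  · have h1 : HasDerivAt (fun t => ‖η‖ • b t) (-‖η‖ • a t) t := by
      refine ((hdb t).const_smul ‖η‖).congr_deriv ?_
      module
    exact (hasDerivAt_const t (0 : ℝ)).prodMk ((hda t).prodMk
      ((hasDerivAt_const t (0 : ℝ)).prodMk h1))
  · simp [ha, hb, ← hηe]

/-- The sign of `r ρ` selects the time direction of escape, contradicting the incoming or the
outgoing tail. The two tails may use different trajectories, as only the common starting point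
matters. -/
theorem trappedSet_eq (hd : Differentiable ℝ α) (hpos : ∀ r, 0 < α r)
    (hmono : ∀ r : ℝ, r ≠ 0 → 0 < r * deriv α r) (h0 : α 0 = 1) (hd0 : deriv α 0 = 0) :
    (trappedSet α : Set (Phase d)) =
      {x | x ∈ cotangent d ∧ radius x = 0 ∧ radialMomentum x = 0} := by
  ext x
  constructor
  · rintro ⟨⟨γ₁, h₁, rfl, ht₁⟩, γ₂, h₂, h₂0, ht₂⟩
    refine ⟨(h₁ 0).1, ?_⟩
    by_contra hne
    have hp := p_pos hpos (h₁ 0).1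
    have hne' : ¬ (radius (γ₁ 0) = 0 ∧ radialMomentum (γ₁ 0) / p α (γ₁ 0) = 0) := by
      rintro ⟨h1, h2⟩
      exact hne ⟨h1, (div_eq_zero_iff.1 h2).resolve_right hp.ne'⟩
    rcases le_total 0 (radius (γ₁ 0) * (radialMomentum (γ₁ 0) / p α (γ₁ 0))) with hs | hs
    · rw [← h₂0] at hs hne'
      exact ht₂ ((h₂.isRadialMotion hd hpos).tendsto_abs_atTop hpos hmono hs hne')
    · have h3 := (h₁.isRadialMotion hd hpos).reverse.tendsto_abs_atTop hpos hmono
        (by simpa using hs) (by simpa using hne')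
      exact ht₁ (by simpa [Function.comp_def] using h3.comp tendsto_neg_atBot_atTop)
  · rintro ⟨hx, hr, hρ⟩
    obtain ⟨γ, hγ, hγ0, hrad⟩ := exists_trajectory_of_radius_eq_zero hd hpos h0 hd0 hx hr hρ
    refine ⟨⟨γ, hγ, hγ0, ?_⟩, γ, hγ, hγ0, ?_⟩
    · simp only [hrad, abs_zero]
      exact not_tendsto_const_atTop _ _
    · simp only [hrad, abs_zero]
      exact not_tendsto_const_atTop _ _

end Trajectory

end

/-! ### Surface measure of bands on the sphere -/

section

open MeasureTheory Set
open scoped Pointwise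

/-- Two points on a line parallel to the axis which lie in the cone `a ‖x‖ ≤ x₀ ≤ b ‖x‖` and in the
unit ball have distance at most a multiple of `b - a`. -/
theorem sub_le_of_mem_cone {s a b L Y u v : ℝ} (hs : 0 ≤ s) (hs1 : s < 1) (ha : -s ≤ a)
    (hb : b ≤ s) (hL : 0 ≤ L) (hab : b - a ≤ L) (hY : 0 ≤ Y)
    (hu : a * √(u ^ 2 + Y) ≤ u ∧ u ≤ b * √(u ^ 2 + Y))
    (hv : √(v ^ 2 + Y) ≤ 1 ∧ a * √(v ^ 2 + Y) ≤ v ∧ v ≤ b * √(v ^ 2 + Y)) (huv : u ≤ v) :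
    v - u ≤ L / (1 - s ^ 2) := by
  have hNu : √(u ^ 2 + Y) ^ 2 = u ^ 2 + Y := Real.sq_sqrt (by positivity)
  have hNv : √(v ^ 2 + Y) ^ 2 = v ^ 2 + Y := Real.sq_sqrt (by positivity)
  have hM0 : 0 ≤ √(u ^ 2 + Y) := Real.sqrt_nonneg _
  have hN0 : 0 ≤ √(v ^ 2 + Y) := Real.sqrt_nonneg _
  set M := √(u ^ 2 + Y)
  set N := √(v ^ 2 + Y)
  have hs2 : 0 < 1 - s ^ 2 := by nlinarith
  rw [le_div_iff₀ hs2]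
  have hau : |u| ≤ s * M := abs_le.2 ⟨by nlinarith [hu.1], by nlinarith [hu.2]⟩
  have hav : |v| ≤ s * N := abs_le.2 ⟨by nlinarith [hv.2.1], by nlinarith [hv.2.2]⟩
  -- Inside the cone the norm is `s`-Lipschitz along the line, because `N² - M² = v² - u²` and `|u +
  -- v| ≤ s (N + M)`.
  have hdiff : |N - M| ≤ s * (v - u) := by
    rcases (add_nonneg hN0 hM0).eq_or_lt with h0 | h0
    · have h1 : N = 0 := by linarith
      have h2 : M = 0 := by linarith
      rw [h1, h2, sub_zero, abs_zero]
      exact mul_nonneg hs (by linarith)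
    · refine le_of_mul_le_mul_right ?_ h0
      calc |N - M| * (N + M) = |N ^ 2 - M ^ 2| := by
            rw [sq_sub_sq, abs_mul, abs_of_pos h0, mul_comm]
        _ = |(v - u) * (v + u)| := by rw [hNu, hNv]; congr 1; ring
        _ = (v - u) * |v + u| := by rw [abs_mul, abs_of_nonneg (by linarith)]
        _ ≤ (v - u) * (s * (N + M)) := by
            refine mul_le_mul_of_nonneg_left ?_ (by linarith)
            linarith [abs_add_le v u]
        _ = _ := by ring
  -- For `|a| ≤ s` this reads `v - u ≤ L + s² (v - u)`; for `a > s` the cone degenerates to its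
  -- apex.
  have h1 : v - u ≤ (b - a) * N + a * (N - M) := by linarith [hu.1, hv.2.2]
  have h2 : (b - a) * N ≤ L := by nlinarith [hv.1]
  by_cases ha0 : a ≤ s
  · have h3 : a * (N - M) ≤ s * (s * (v - u)) := by
      calc a * (N - M) ≤ |a * (N - M)| := le_abs_self _
        _ = |a| * |N - M| := abs_mul _ _
        _ ≤ s * (s * (v - u)) := by
            gcongr
            exact abs_le.2 ⟨ha, ha0⟩
    linarith
  · have h3 : a * M ≤ s * M := by nlinarith [hu.1, hu.2]
    have h4 : M = 0 := by nlinarith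
    have h5 : N = 0 := by nlinarith [hv.2.1, hv.2.2]
    rw [h4, h5] at h1
    nlinarith

/-- The surface measure of a band `a ≤ ⟨θ, w⟩ ≤ b` which stays away from the poles `±θ` is at most
a multiple of its height. -/
theorem exists_sphereMeasure_band_le (k : ℕ) {s : ℝ} (hs : 0 ≤ s) (hs1 : s < 1) :
    ∃ C : ℝ, 0 < C ∧ ∀ (θ : E (k + 1)) (a b L : ℝ), ‖θ‖ = 1 → -s ≤ a → b ≤ s → 0 ≤ L →
      b - a ≤ L →
      sphereMeasure (k + 1) {w | a ≤ inner ℝ θ (w : E (k + 1)) ∧ inner ℝ θ (w : E (k + 1)) ≤ b}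
        ≤ ENNReal.ofReal (C * L) := by
  have hs2 : 0 < 1 - s ^ 2 := by nlinarith
  refine ⟨((k : ℝ) + 1) * (2 ^ k / (1 - s ^ 2)), by positivity, fun θ a b L hθ ha hb hL hab => ?_⟩
  obtain ⟨e, he⟩ : ∃ e : OrthonormalBasis (Fin (k + 1)) ℝ (E (k + 1)), e 0 = θ := by
    have hcard : Module.finrank ℝ (E (k + 1)) = Fintype.card (Fin (k + 1)) := by simp
    have hon : Orthonormal ℝ (({0} : Set (Fin (k + 1))).domRestrict fun _ => θ) :=
      ⟨fun _ => hθ, fun i j hij => absurd (Subsingleton.elim i j) hij⟩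
    obtain ⟨e, he⟩ := hon.exists_orthonormalBasis_extension_of_card_eq hcard
    exact ⟨e, he 0 rfl⟩
  let Φ : E (k + 1) → ℝ × (Fin k → ℝ) := fun x =>
    MeasurableEquiv.piFinSuccAbove (fun _ => ℝ) 0 (WithLp.ofLp (e.repr x))
  have hΦ : MeasurePreserving Φ volume volume :=
    (volume_preserving_piFinSuccAbove (fun _ : Fin (k + 1) => ℝ) 0).comp
      ((PiLp.volume_preserving_ofLp (Fin (k + 1))).comp e.measurePreserving_repr)
  have hΦ1 : ∀ x, (Φ x).1 = inner ℝ θ x := fun x => by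
    rw [← he, ← e.repr_apply_apply]
    rfl
  have hΦn : ∀ x, ‖x‖ = √((Φ x).1 ^ 2 + ∑ j, (Φ x).2 j ^ 2) := fun x => by
    rw [← e.repr.norm_map x, EuclideanSpace.norm_eq, Fin.sum_univ_succ]
    simp only [Real.norm_eq_abs, sq_abs]
    rfl
  let A : Set (ℝ × (Fin k → ℝ)) := {z | √(z.1 ^ 2 + ∑ j, z.2 j ^ 2) ≤ 1 ∧
    a * √(z.1 ^ 2 + ∑ j, z.2 j ^ 2) ≤ z.1 ∧ z.1 ≤ b * √(z.1 ^ 2 + ∑ j, z.2 j ^ 2)}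
  have hA : MeasurableSet A := by
    have hcont : Continuous fun z : ℝ × (Fin k → ℝ) => √(z.1 ^ 2 + ∑ j, z.2 j ^ 2) := by fun_prop
    exact ((isClosed_le hcont continuous_const).inter
      ((isClosed_le (continuous_const.mul hcont) continuous_fst).inter
        (isClosed_le continuous_fst (continuous_const.mul hcont)))).measurableSet
  -- Fubini along the axis `θ`: every slice has diameter at most `L / (1 - s²)`, and the base point
  -- lies in the cube `[-1, 1]^k`.
  have hvolA : volume A ≤ ENNReal.ofReal (2 ^ k / (1 - s ^ 2) * L) := by
    have hslice : ∀ y : Fin k → ℝ, volume ((fun u : ℝ => (u, y)) ⁻¹' A)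
        ≤ (Icc (fun _ => -1) fun _ => (1 : ℝ)).indicator
          (fun _ => ENNReal.ofReal (L / (1 - s ^ 2))) y := by
      intro y
      have hY : 0 ≤ ∑ j, y j ^ 2 := Finset.sum_nonneg fun j _ => sq_nonneg _
      by_cases hy : y ∈ Icc (fun _ => -1) fun _ => (1 : ℝ)
      · rw [indicator_of_mem hy]
        refine (Real.volume_le_diam _).trans (Metric.ediam_le fun u hu v hv => ?_)
        rw [edist_dist, Real.dist_eq]
        refine ENNReal.ofReal_le_ofReal ?_
        rcases le_total u v with h | h
        · rw [abs_sub_comm, abs_of_nonneg (by linarith)]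
          exact sub_le_of_mem_cone hs hs1 ha hb hL hab hY hu.2 hv h
        · rw [abs_of_nonneg (by linarith)]
          exact sub_le_of_mem_cone hs hs1 ha hb hL hab hY hv.2 hu h
      · rw [indicator_of_notMem hy, nonpos_iff_eq_zero]
        convert measure_empty (μ := (volume : Measure ℝ))
        refine eq_empty_of_forall_notMem fun u hu => hy ?_
        have h1 : √(u ^ 2 + ∑ j, y j ^ 2) ≤ 1 := hu.1
        rw [Real.sqrt_le_iff, one_pow] at h1
        replace h1 := h1.2
        have h2 : ∀ j, y j ∈ Icc (-1 : ℝ) 1 := fun j => by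
          have h3 := Finset.single_le_sum (f := fun j => y j ^ 2) (fun j _ => sq_nonneg _)
            (Finset.mem_univ j)
          have h4 : y j ^ 2 ≤ 1 := by
            nlinarith [sq_nonneg u]
          exact abs_le.1 (abs_le_of_sq_le_sq (by simpa using h4) zero_le_one)
        exact ⟨fun j => (h2 j).1, fun j => (h2 j).2⟩
    rw [Measure.volume_eq_prod, Measure.prod_apply_symm hA]
    refine (lintegral_mono hslice).trans ?_
    rw [lintegral_indicator_const measurableSet_Icc, Real.volume_Icc_pi]
    simp only [Finset.prod_const, Finset.card_univ, Fintype.card_fin]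
    rw [← ENNReal.ofReal_pow (by norm_num), ← ENNReal.ofReal_mul (by positivity)]
    refine ENNReal.ofReal_le_ofReal (le_of_eq ?_)
    norm_num
    ring
  have hmeas : MeasurableSet {w : Metric.sphere (0 : E (k + 1)) 1 |
      a ≤ inner ℝ θ (w : E (k + 1)) ∧ inner ℝ θ (w : E (k + 1)) ≤ b} := by
    have hcont : Continuous fun w : Metric.sphere (0 : E (k + 1)) 1 =>
        inner ℝ θ (w : E (k + 1)) := continuous_const.inner continuous_subtype_val
    exact ((isClosed_le continuous_const hcont).inter
      (isClosed_le hcont continuous_const)).measurableSet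
  -- The surface measure is the dimension times the volume of the cone over the set.
  rw [sphereMeasure, Measure.toSphere_apply' _ hmeas]
  have hsub : Ioo (0 : ℝ) 1 • (Subtype.val '' {w : Metric.sphere (0 : E (k + 1)) 1 |
      a ≤ inner ℝ θ (w : E (k + 1)) ∧ inner ℝ θ (w : E (k + 1)) ≤ b}) ⊆ Φ ⁻¹' A := by
    rintro _ ⟨c, hc, _, ⟨w, hw, rfl⟩, rfl⟩
    have hw1 : ‖(w : E (k + 1))‖ = 1 := by simp
    have hn : ‖c • (w : E (k + 1))‖ = c := by
      rw [norm_smul, hw1, mul_one, Real.norm_of_nonneg hc.1.le]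
    have hc0 := hc.1
    have hsqrt := hΦn (c • (w : E (k + 1)))
    rw [hn] at hsqrt
    simp only [mem_preimage, A, mem_ofPred_eq]
    rw [← hsqrt, hΦ1, inner_smul_right]
    refine ⟨hc.2.le, ?_, ?_⟩
    · nlinarith [hw.1]
    · nlinarith [hw.2]
  calc _ ≤ ((k + 1 : ℕ) : ENNReal) * volume (Φ ⁻¹' A) := by
        gcongr
        simp
    _ = ((k + 1 : ℕ) : ENNReal) * volume A := by
        rw [hΦ.measure_preimage hA.nullMeasurableSet]
    _ ≤ ENNReal.ofReal ((k : ℝ) + 1) * ENNReal.ofReal (2 ^ k / (1 - s ^ 2) * L) := by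
        gcongr
        rw [← ENNReal.ofReal_natCast]
        push_cast
        exact le_rfl
    _ = _ := by
        rw [← ENNReal.ofReal_mul (by positivity)]
        ring_nf

/-- The surface measure of the set where `⟨θ, w⟩²` is within `κ` of `q`. -/
theorem exists_sphereMeasure_sq_near_le (k : ℕ) {s : ℝ} (hs : 0 ≤ s) (hs1 : s < 1) :
    ∃ C : ℝ, 0 < C ∧ ∀ (θ : E (k + 1)) (q κ : ℝ), ‖θ‖ = 1 → 0 ≤ q → 0 < κ →
      sphereMeasure (k + 1) {w | |inner ℝ θ (w : E (k + 1))| ≤ s ∧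
        |inner ℝ θ (w : E (k + 1)) ^ 2 - q| ≤ κ} ≤ ENNReal.ofReal (C * (κ / √(q + κ))) := by
  obtain ⟨C, hC, H⟩ := exists_sphereMeasure_band_le k hs hs1
  refine ⟨4 * C, by positivity, fun θ q κ hθ hq hκ => ?_⟩
  -- For `q < κ` the square root is `0` by convention, and the lower constraint is void. In both
  -- cases `b (b - a) ≤ 2 κ`.
  set a := √(q - κ)
  set b := √(q + κ) with hbdef
  have hb0 : 0 < b := Real.sqrt_pos.2 (by linarith)
  have ha0 : 0 ≤ a := Real.sqrt_nonneg _
  have hb2 : b ^ 2 = q + κ := Real.sq_sqrt (by linarith)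
  have hab : b - a ≤ 2 * κ / b := by
    rw [le_div_iff₀ hb0]
    rcases le_total κ q with h | h
    · have ha2 : a ^ 2 = q - κ := Real.sq_sqrt (by linarith)
      have : a ≤ b := Real.sqrt_le_sqrt (by linarith)
      nlinarith
    · nlinarith
  have hL : 0 ≤ 2 * κ / b := by positivity
  have hmin : min b s - a ≤ 2 * κ / b := by linarith [min_le_left b s]
  have h1 := H θ a (min b s) (2 * κ / b) hθ (by linarith) (min_le_right _ _) hL hmin
  have h2 := H θ (-min b s) (-a) (2 * κ / b) hθ (by linarith [min_le_right b s]) (by linarith) hL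
    (by linarith)
  refine (measure_mono (t := {w : Metric.sphere (0 : E (k + 1)) 1 |
    a ≤ inner ℝ θ (w : E (k + 1)) ∧ inner ℝ θ (w : E (k + 1)) ≤ min b s} ∪
      {w : Metric.sphere (0 : E (k + 1)) 1 | -min b s ≤ inner ℝ θ (w : E (k + 1)) ∧
        inner ℝ θ (w : E (k + 1)) ≤ -a}) ?_).trans ((measure_union_le _ _).trans
        ((add_le_add h1 h2).trans ?_))
  · rintro w ⟨hw1, hw2⟩
    have hup : |inner ℝ θ (w : E (k + 1))| ≤ min b s := by
      refine le_min (Real.abs_le_sqrt ?_) hw1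
      linarith [(abs_le.1 hw2).2]
    have hlow : a ≤ |inner ℝ θ (w : E (k + 1))| := by
      rw [← Real.sqrt_sq_eq_abs]
      exact Real.sqrt_le_sqrt (by linarith [(abs_le.1 hw2).1])
    rcases le_total 0 (inner ℝ θ (w : E (k + 1))) with h | h
    · rw [abs_of_nonneg h] at hup hlow
      exact Or.inl ⟨hlow, hup⟩
    · rw [abs_of_nonpos h] at hup hlow
      exact Or.inr ⟨by linarith, by linarith⟩
  · rw [← ENNReal.ofReal_add (by positivity) (by positivity)]
    refine ENNReal.ofReal_le_ofReal (le_of_eq ?_)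
    ring

/-! ### Slicing the Liouville measure -/

section Liouville

variable {d : ℕ} {α : ℝ → ℝ}

instance : IsFiniteMeasure (sphereMeasure d) := by unfold sphereMeasure; infer_instance

theorem continuous_cosphereParam (hα : Continuous α) :
    Continuous (cosphereParam α : _ → Phase d) := by
  unfold cosphereParam
  fun_prop

/-- Pythagoras for a unit vector. A condition on `p₀` thus becomes a band condition on `⟨θ, w⟩`. -/
theorem p₀_cosphereParam (r : ℝ) (z : Metric.sphere (0 : E d) 1 × Metric.sphere (0 : E d) 1) :
    p₀ (cosphereParam α (r, z)) = α r ^ 2 * (1 - inner ℝ (z.1 : E d) (z.2 : E d) ^ 2) := by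
  have h1 : ‖(z.1 : E d)‖ = 1 := by simp
  have h2 : ‖(z.2 : E d)‖ = 1 := by simp
  simp only [p₀, cosphereParam, angularMomentum]
  rw [norm_smul, mul_pow, Real.norm_eq_abs, sq_abs, norm_sub_sq_real, norm_smul, inner_smul_right,
    h1, h2, real_inner_comm, Real.norm_eq_abs, mul_one, sq_abs]
  ring

/-- The Liouville measure is computed by integrating over the slices of fixed `r`. -/
theorem liouville_le (hα : Continuous α) (hpos : ∀ r, 0 < α r) {R A : ℝ}
    (hA : ∀ r, |r| ≤ R → α r ≤ A) {S : Set (Phase d)} (hS : MeasurableSet S)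
    (hSR : ∀ x ∈ S, |radius x| ≤ R) {F : ℝ → ENNReal}
    (hF : ∀ r, |r| ≤ R → ((sphereMeasure d).prod (sphereMeasure d))
      {z | cosphereParam α (r, z) ∈ S} ≤ F r) :
    liouville α S ≤ ∫⁻ r in Icc (-R) R, ENNReal.ofReal (A ^ (d - 1)) * F r := by
  have hm := (continuous_cosphereParam (d := d) hα).measurable
  rw [liouville, Measure.map_apply hm hS, Measure.prod_apply (hm hS)]
  have hdens : Measurable fun r => ENNReal.ofReal (α r ^ (d - 1)) :=
    (hα.pow (d - 1)).measurable.ennreal_ofReal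
  refine (lintegral_withDensity_le_lintegral_mul _ hdens _).trans ?_
  rw [← lintegral_indicator measurableSet_Icc]
  refine lintegral_mono fun r => ?_
  by_cases hr : |r| ≤ R
  · rw [indicator_of_mem (show r ∈ Icc (-R) R from abs_le.1 hr)]
    refine mul_le_mul' (ENNReal.ofReal_le_ofReal ?_) (hF r hr)
    exact pow_le_pow_left₀ (hpos r).le (hA r hr) _
  · have hempty : Prod.mk r ⁻¹' (cosphereParam α ⁻¹' S) = ∅ :=
      eq_empty_of_forall_notMem fun z hz => hr (hSR _ hz)
    simp [hempty]

end Liouville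

end

/-! ### Volume of the nearly critical set and the trapped volume -/

section

open MeasureTheory Set Filter

/-- The width of the resonant band over `r`, in terms of the rescaled variable `r / δ`. -/
theorem band_width_le {n : ℕ} (hn : 2 ≤ n) {c K δ q x : ℝ} (hc : 0 < c) (hK : 0 < K)
    (hδ : 0 < δ) (hq : c * |x| ^ (2 * n) ≤ q) :
    K * δ ^ (2 * n) / √(q + K * δ ^ (2 * n))
      ≤ 2 * K / √(min c K) * δ ^ n * (1 + (x / δ) ^ 2)⁻¹ := by
  have hm : 0 < min c K := lt_min hc hK
  set u := |x| / δ with hu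
  have hu0 : 0 ≤ u := by positivity
  have hxu : (x / δ) ^ 2 = u ^ 2 := by rw [hu, div_pow, div_pow, sq_abs]
  -- Here `n ≥ 2` enters: the width decays at least like `u⁻²`, hence is integrable in `u = |x| /
  -- δ`.
  have h1 : (1 + u ^ 2) ^ 2 ≤ 4 * (1 + u ^ (2 * n)) := by
    have h2 : u ^ 4 ≤ 1 + u ^ (2 * n) := by
      rcases le_total u 1 with h | h
      · have : u ^ 4 ≤ 1 := pow_le_one₀ hu0 h
        have : 0 ≤ u ^ (2 * n) := by positivity
        linarith
      · have : u ^ 4 ≤ u ^ (2 * n) := pow_le_pow_right₀ h (by omega)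
        linarith
    have h3 : 0 ≤ u ^ (2 * n) := by positivity
    nlinarith [sq_nonneg (u ^ 2 - 1)]
  have h4 : √(min c K) * δ ^ n * ((1 + u ^ 2) / 2) ≤ √(q + K * δ ^ (2 * n)) := by
    refine Real.le_sqrt_of_sq_le ?_
    have hxd : |x| = u * δ := by rw [hu]; field_simp
    calc (√(min c K) * δ ^ n * ((1 + u ^ 2) / 2)) ^ 2
        = min c K * δ ^ (2 * n) * ((1 + u ^ 2) ^ 2 / 4) := by
          rw [mul_pow, mul_pow, Real.sq_sqrt hm.le]; ring
      _ ≤ min c K * δ ^ (2 * n) * (1 + u ^ (2 * n)) := by gcongr; linarith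
      _ = min c K * (u * δ) ^ (2 * n) + min c K * δ ^ (2 * n) := by ring
      _ ≤ c * (u * δ) ^ (2 * n) + K * δ ^ (2 * n) := by
          gcongr
          · exact min_le_left _ _
          · exact min_le_right _ _
      _ ≤ q + K * δ ^ (2 * n) := by rw [← hxd]; linarith
  have hs := Real.sqrt_pos.2 hm
  rw [hxu]
  calc K * δ ^ (2 * n) / √(q + K * δ ^ (2 * n))
      ≤ K * δ ^ (2 * n) / (√(min c K) * δ ^ n * ((1 + u ^ 2) / 2)) := by gcongr
    _ = _ := by
        rw [two_mul n, pow_add]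
        field_simp

theorem lintegral_inv_one_add_sq_scaled {δ : ℝ} (hδ : 0 < δ) :
    ∫⁻ x, ENNReal.ofReal (1 + (x / δ) ^ 2)⁻¹ = ENNReal.ofReal (δ * Real.pi) := by
  rw [← ofReal_integral_eq_lintegral_ofReal (integrable_inv_one_add_sq.comp_div hδ.ne')
    (Eventually.of_forall fun x => by positivity),
    Measure.integral_comp_div (fun x : ℝ => (1 + x ^ 2)⁻¹), integral_univ_inv_one_add_sq,
    abs_of_pos hδ, smul_eq_mul]

section Volume

variable {d n : ℕ} {α : ℝ → ℝ}

/-- The set of points over `|r| ≤ R` with `|p₀ - 1| ≤ κ`. -/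
def nearCritical (d : ℕ) (R κ : ℝ) : Set (Phase d) := {x | |radius x| ≤ R ∧ |p₀ x - 1| ≤ κ}

theorem isClosed_radius_le (R : ℝ) : IsClosed {x : Phase d | |radius x| ≤ R} :=
  isClosed_le (continuous_abs.comp continuous_fst) continuous_const

theorem measurableSet_nearCritical (R κ : ℝ) : MeasurableSet (nearCritical d R κ) := by
  have h : Continuous (p₀ : Phase d → ℝ) := by
    unfold p₀ angularMomentum
    fun_prop
  exact ((isClosed_radius_le R).inter
    (isClosed_le (h.sub continuous_const).abs continuous_const)).measurableSet

theorem liouville_radius_le_lt_top (hα : Continuous α) (hpos : ∀ r, 0 < α r) (R : ℝ) :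
    liouville α {x : Phase d | |radius x| ≤ R} < ⊤ := by
  obtain ⟨A, hA⟩ := (isCompact_Icc (a := -R) (b := R)).exists_bound_of_continuousOn hα.continuousOn
  refine (liouville_le hα hpos (A := A)
    (fun r hr => (le_abs_self _).trans (hA r (abs_le.1 hr)))
    (isClosed_radius_le R).measurableSet (fun x hx => hx)
    (F := fun _ => ((sphereMeasure d).prod (sphereMeasure d)) univ)
    fun r _ => measure_mono (subset_univ _)).trans_lt ?_
  rw [setLIntegral_const, Real.volume_Icc]
  exact ENNReal.mul_lt_top (ENNReal.mul_lt_top ENNReal.ofReal_lt_top (measure_lt_top _ _))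
    ENNReal.ofReal_lt_top

/-- The Liouville measure of the points with nearly critical angular momentum. -/
theorem exists_liouville_nearCritical_le (hd : 2 ≤ d) (hn : 2 ≤ n) (hsmooth : ContDiff ℝ ∞ α)
    (hpos : ∀ r, 0 < α r)
    (hzero : (fun r : ℝ => α r - (1 + r ^ (2 * n) / 2)) =O[𝓝 0] fun r : ℝ => r ^ (2 * n + 1))
    (hmono : ∀ r : ℝ, r ≠ 0 → 0 < r * deriv α r) (R : ℝ) {K : ℝ} (hK : 0 < K) :
    ∃ C : ℝ, 0 < C ∧ ∀ δ : ℝ, 0 < δ → K * δ ^ (2 * n) ≤ 1 / 2 →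
      liouville α (nearCritical d R (K * δ ^ (2 * n))) ≤ ENNReal.ofReal (C * δ ^ (n + 1)) := by
  obtain ⟨k, rfl⟩ : ∃ k, d = k + 1 := ⟨d - 1, by omega⟩
  have hα := hsmooth.continuous
  have hone := one_le_profile hsmooth hmono (profile_zero hzero hn)
  obtain ⟨A₀, hA₀⟩ :=
    (isCompact_Icc (a := -R) (b := R)).exists_bound_of_continuousOn hα.continuousOn
  obtain ⟨A, hA1, hA⟩ : ∃ A : ℝ, 1 ≤ A ∧ ∀ r, |r| ≤ R → α r ≤ A :=
    ⟨max 1 A₀, le_max_left _ _, fun r hr =>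
      ((le_abs_self _).trans (hA₀ r (abs_le.1 hr))).trans (le_max_right _ _)⟩
  obtain ⟨c, hc, hlow⟩ := exists_profile_lower_bound hn hsmooth hzero hmono R
  have hA2 : 1 / (2 * A ^ 2) ≤ 1 / 2 := by
    rw [div_le_div_iff₀ (by positivity) (by norm_num)]
    nlinarith
  have hA3 : 0 < 1 / (2 * A ^ 2) := by positivity
  -- `p₀ ≥ 1 / 2` and `α ≤ A` give `⟨θ, w⟩² ≤ 1 - 1 / (2 A²)`, so the bands avoid the poles
  -- uniformly.
  obtain ⟨C, hC, hband⟩ := exists_sphereMeasure_sq_near_le k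
    (Real.sqrt_nonneg (1 - 1 / (2 * A ^ 2)))
    (show √(1 - 1 / (2 * A ^ 2)) < 1 by
      rw [Real.sqrt_lt' one_pos]; linarith)
  set m := ((sphereMeasure (k + 1)) univ).toReal with hm
  set D := 2 * K / √(min c K)
  have hD : 0 < D := div_pos (by positivity) (Real.sqrt_pos.2 (lt_min hc hK))
  refine ⟨A ^ k * (C * D * (m + 1)) * Real.pi, by positivity, fun δ hδ hδK => ?_⟩
  set κ := K * δ ^ (2 * n) with hκ
  have hκ0 : 0 < κ := by positivity
  refine (liouville_le hα hpos hA (measurableSet_nearCritical R κ) (fun x hx => hx.1)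
    (F := fun r => ENNReal.ofReal ((C * D * (m + 1)) * δ ^ n) *
      ENNReal.ofReal (1 + (r / δ) ^ 2)⁻¹) ?_).trans ?_
  · intro r hr
    have hmeas : MeasurableSet {z : Metric.sphere (0 : E (k + 1)) 1 × Metric.sphere (0 : E (k + 1)) 1 |
        cosphereParam α (r, z) ∈ nearCritical (k + 1) R κ} :=
      ((continuous_cosphereParam hα).comp (Continuous.prodMk_right r)).measurable
        (measurableSet_nearCritical R κ)
    rw [Measure.prod_apply hmeas]
    have hslice : ∀ θ : Metric.sphere (0 : E (k + 1)) 1,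
        sphereMeasure (k + 1) (Prod.mk θ ⁻¹' {z | cosphereParam α (r, z) ∈
          nearCritical (k + 1) R κ})
        ≤ ENNReal.ofReal (C * (D * δ ^ n * (1 + (r / δ) ^ 2)⁻¹)) := by
      intro θ
      have hα1 : 1 ≤ α r ^ 2 := one_le_pow₀ (hone r)
      have hαA : α r ^ 2 ≤ A ^ 2 := pow_le_pow_left₀ (hpos r).le (hA r hr) 2
      have hq : 0 ≤ 1 - (α r ^ 2)⁻¹ := by linarith [inv_le_one_of_one_le₀ hα1]
      refine le_trans (measure_mono ?_) ((hband θ (1 - (α r ^ 2)⁻¹) κ (by simp) hq hκ0).trans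
        (ENNReal.ofReal_le_ofReal (mul_le_mul_of_nonneg_left
          (band_width_le hn hc hK hδ (hlow r hr)) hC.le)))
      rintro w ⟨_, hw⟩
      rw [p₀_cosphereParam] at hw
      simp only at hw
      have hinv : α r ^ 2 * (α r ^ 2)⁻¹ = 1 := mul_inv_cancel₀ (by positivity)
      set ρ : ℝ := inner ℝ (θ : E (k + 1)) (w : E (k + 1))
      obtain ⟨hw1, hw2⟩ := abs_le.1 hw
      constructor
      · refine Real.abs_le_sqrt ?_
        have h1 : 1 / 2 ≤ A ^ 2 * (1 - ρ ^ 2) := by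
          have h2 : 1 / 2 ≤ α r ^ 2 * (1 - ρ ^ 2) := by linarith
          have h3 : 0 ≤ 1 - ρ ^ 2 := by
            by_contra! h
            nlinarith
          exact h2.trans (mul_le_mul_of_nonneg_right hαA h3)
        have h4 : 1 / (2 * A ^ 2) ≤ 1 - ρ ^ 2 := by
          rw [div_le_iff₀ (by positivity)]
          linarith
        linarith
      · have h1 : α r ^ 2 * |ρ ^ 2 - (1 - (α r ^ 2)⁻¹)| ≤ κ := by
          rw [← abs_of_pos (show 0 < α r ^ 2 by positivity), ← abs_mul, ← abs_neg,
            abs_of_pos (show 0 < α r ^ 2 by positivity)]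
          refine le_trans (le_of_eq ?_) hw
          congr 1
          linear_combination (-1 : ℝ) * hinv
        have h2 := abs_nonneg (ρ ^ 2 - (1 - (α r ^ 2)⁻¹))
        show |ρ ^ 2 - (1 - (α r ^ 2)⁻¹)| ≤ κ
        nlinarith
    refine (lintegral_mono hslice).trans ?_
    rw [lintegral_const, ← ENNReal.ofReal_toReal (measure_ne_top (sphereMeasure (k + 1)) univ),
      ← hm, ← ENNReal.ofReal_mul (by positivity), ← ENNReal.ofReal_mul (by positivity)]
    refine ENNReal.ofReal_le_ofReal ?_
    have h1 : 0 ≤ C * (D * δ ^ n * (1 + (r / δ) ^ 2)⁻¹) := by positivity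
    calc _ ≤ C * (D * δ ^ n * (1 + (r / δ) ^ 2)⁻¹) * (m + 1) := by gcongr; linarith
      _ = _ := by ring
  -- Integrating over all `r` contributes the last factor `δ`.
  · refine (setLIntegral_le_lintegral _ _).trans ?_
    simp only [← mul_assoc]
    rw [lintegral_const_mul' _ _ (ENNReal.mul_ne_top ENNReal.ofReal_ne_top ENNReal.ofReal_ne_top),
      lintegral_inv_one_add_sq_scaled hδ, ← ENNReal.ofReal_mul (by positivity),
      ← ENNReal.ofReal_mul (by positivity)]
    refine ENNReal.ofReal_le_ofReal (le_of_eq ?_)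
    rw [Nat.add_sub_cancel]
    ring

/-- For large `t` the trapped points are nearly critical with `δ = scale n t`. For bounded `t` the
finite volume over `|r| ≤ R` suffices, as `scale n` is decreasing. Monotonicity of outer measure
makes measurability of the trapped points irrelevant. -/
theorem exists_trappedVolume_le (hd : 2 ≤ d) (hn : 2 ≤ n) (hsmooth : ContDiff ℝ ∞ α)
    (hpos : ∀ r, 0 < α r)
    (hzero : (fun r : ℝ => α r - (1 + r ^ (2 * n) / 2)) =O[𝓝 0] fun r : ℝ => r ^ (2 * n + 1))
    (hmono : ∀ r : ℝ, r ≠ 0 → 0 < r * deriv α r) {B : Set (ℝ × E d)} (hB : IsCompact B) :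
    ∃ C : ℝ, 0 < C ∧ ∀ t : ℝ, 1 ≤ t →
      trappedVolume α B t ≤ ENNReal.ofReal (C * scale n t ^ (n + 1)) := by
  have hdiff : Differentiable ℝ α := hsmooth.differentiable (by simp)
  obtain ⟨R, hR0, hR⟩ := hB.isBounded.exists_pos_norm_le
  have hRB : ∀ x ∈ B, |x.1| ≤ R := fun x hx => (norm_fst_le x).trans (hR x hx)
  obtain ⟨K, hK, hmom⟩ := exists_momentum_bound hn hsmooth hpos hzero hmono hR0.le
  obtain ⟨C, hC, hvol⟩ :=
    exists_liouville_nearCritical_le (d := d) hd hn hsmooth hpos hzero hmono R hK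
  have hn' : (2 : ℝ) ≤ n := by exact_mod_cast hn
  have hlim : Tendsto (fun t => K * scale n t ^ (2 * n)) atTop (𝓝 0) := by
    have h1 : Tendsto (scale n) atTop (𝓝 0) :=
      tendsto_rpow_neg_atTop (by apply div_pos one_pos; linarith)
    have h2 := (h1.pow (2 * n)).const_mul K
    rwa [zero_pow (by omega), mul_zero] at h2
  obtain ⟨T, hT⟩ := eventually_atTop.1 ((hlim.eventually_le_const
    (show (0 : ℝ) < 1 / 2 by norm_num)).and ((eventually_gt_atTop (4 * R)).and
      (eventually_ge_atTop 1)))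
  have hT1 : 1 ≤ T := (hT T le_rfl).2.2
  set V := (liouville α {x : Phase d | |radius x| ≤ R}).toReal with hV
  have hV0 : 0 ≤ V := ENNReal.toReal_nonneg
  have hsT := scale_pos (n := n) (zero_lt_one.trans_le hT1)
  refine ⟨C + V / scale n T ^ (n + 1), by positivity, fun t ht => ?_⟩
  have ht0 : 0 < t := by linarith
  have hst := scale_pos (n := n) ht0
  rcases le_total T t with hle | hle
  · obtain ⟨h1, h2, -⟩ := hT t hle
    refine (measure_mono ?_).trans ((hvol (scale n t) hst h1).trans
      (ENNReal.ofReal_le_ofReal (by gcongr; simp; positivity)))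
    rintro x ⟨hx, hxB, y, ⟨γ, hγ, rfl, rfl⟩, hyB⟩
    have h3 := hmom _ _ _ t (hγ.isRadialMotion hdiff hpos) h2 (hRB _ hxB) (hRB _ hyB)
    rw [hx.2, one_pow, div_one] at h3
    exact ⟨hRB _ hxB, h3⟩
  · have hsub : cosphere α ∩ trappedFor α B t ⊆ {x : Phase d | |radius x| ≤ R} :=
      fun x hx => hRB _ hx.2.1
    refine (measure_mono hsub).trans ?_
    rw [← ENNReal.ofReal_toReal (liouville_radius_le_lt_top hsmooth.continuous hpos R).ne, ← hV]
    refine ENNReal.ofReal_le_ofReal ?_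
    have h1 : scale n T ≤ scale n t :=
      Real.rpow_le_rpow_of_nonpos ht0 hle (by
        have : 0 ≤ 1 / ((n : ℝ) - 1) := div_nonneg zero_le_one (by linarith)
        linarith)
    calc V = V / scale n T ^ (n + 1) * scale n T ^ (n + 1) := by field_simp
      _ ≤ V / scale n T ^ (n + 1) * scale n t ^ (n + 1) := by gcongr
      _ ≤ _ := by gcongr; linarith

end Volume

end

end Revolution


/-! ### Assembly of the three claims -/

theorem mainTheorem5 (d n : ℕ) (hd : 2 ≤ d) (hn : 2 ≤ n) (α : ℝ → ℝ)
    (hsmooth : ContDiff ℝ ∞ α) (hpos : ∀ r, 0 < α r)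
    (hend : ∃ R : ℝ, ∀ r : ℝ, R < |r| → α r = |r|)
    (hzero : (fun r : ℝ => α r - (1 + r ^ (2 * n) / 2)) =O[𝓝 0] fun r : ℝ => r ^ (2 * n + 1))
    (hmono : ∀ r : ℝ, r ≠ 0 → 0 < r * deriv α r) :
    (Revolution.trappedSet α : Set (Revolution.Phase d)) =
        {x | x ∈ Revolution.cotangent d ∧ Revolution.radius x = 0 ∧
          Revolution.radialMomentum x = 0} ∧
    (∃ τ₀ : ℝ, 0 < τ₀ ∧ ∀ τ : ℝ, 0 < τ → τ ≤ τ₀ →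
      ∃ C T : ℝ, 0 < C ∧ 0 < T ∧
        ∀ (γ : ℝ → Revolution.Phase d) (t : ℝ), Revolution.IsTrajectory α γ → T ≤ t →
          Revolution.p α (γ 0) = 1 → 1 - τ ≤ Revolution.p₀ (γ 0) →
          0 ≤ Revolution.radius (γ 0) → 0 ≤ Revolution.radialMomentum (γ 0) →
          Revolution.radius (γ t) ≤ τ →
          Revolution.radius (γ 0) ≤ C * t ^ (-(1 / ((n : ℝ) - 1))) ∧
          Revolution.radialMomentum (γ 0) ≤ C * t ^ (-((n : ℝ) / ((n : ℝ) - 1)))) ∧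
    (∀ B : Set (ℝ × Revolution.E d), B ⊆ Revolution.base d → IsCompact B →
      ∃ C : ℝ, 0 < C ∧ ∀ t : ℝ, 1 ≤ t →
        Revolution.trappedVolume α B t ≤
          ENNReal.ofReal (C * t ^ (-(((n : ℝ) + 1) / ((n : ℝ) - 1))))) := by
  have hdiff : Differentiable ℝ α := hsmooth.differentiable (by simp)
  refine ⟨Revolution.trappedSet_eq hdiff hpos hmono (Revolution.profile_zero hzero hn)
    (Revolution.deriv_profile_zero hsmooth hmono), ⟨1 / 2, by norm_num, fun τ hτ hτ' => ?_⟩,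
    fun B _ hB => ?_⟩
  · obtain ⟨C, hC, H⟩ := Revolution.exists_decay_bound hn hsmooth hpos hzero hmono τ
    refine ⟨C, 1, hC, one_pos, fun γ t hγ ht hp hp₀ hr hρ hrt => ?_⟩
    have ht0 : 0 < t := by linarith
    have hm := hγ.isRadialMotion hdiff hpos
    simp only [hp, one_pow, div_one] at hm
    have hs := Revolution.scale_pos (n := n) ht0
    rw [← Revolution.scale_pow ht0 n]
    by_cases hne : Revolution.radius (γ 0) = 0 ∧ Revolution.radialMomentum (γ 0) = 0
    · rw [hne.1, hne.2]
      exact ⟨(mul_pos hC hs).le, by positivity⟩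
    -- Only an upper bound on `r(t)` is given; outward motion keeps `r(t) ≥ 0`, so `|r(t)| ≤ τ`. The
    -- choice `τ₀ = 1 / 2` ensures `q ≥ 1 / 2`.
    · have hrt0 := (Revolution.nonneg_of_repulsive hm.hasDerivAt_pos hm.hasDerivAt_vel
        (hm.force_nonneg hpos hmono) hr hρ hne ht0.le).1
      have h := H _ _ _ t hm (by linarith) ht0 ((abs_of_nonneg hrt0).trans_le hrt)
        (mul_nonneg hr hρ)
      exact ⟨(le_abs_self _).trans h.1, (le_abs_self _).trans h.2⟩
  · obtain ⟨C, hC, H⟩ :=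
      Revolution.exists_trappedVolume_le hd hn hsmooth hpos hzero hmono hB
    refine ⟨C, hC, fun t ht => ?_⟩
    have h := H t ht
    rw [Revolution.scale_pow (by linarith)] at h
    exact_mod_cast h
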